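/- Let $(X,\mu)$ be a probability space (for example, a Lebesgue space) and let $T:X\to X$ be an invertible, bimeasurable, $\mu$-preserving, ergodic transformation. Let $\widehat T f=f\circ T$ be the corresponding unitary operator on the complex space $L_2(X,\mu)$, and let $H\subset L_2(X,\mu)$ be the orthogonal complement of the constants. All spectral notions for an automorphism refer to its unitary operator restricted to the functions with zero mean. Simple spectrum means that there is a cyclic vector. Homogeneous spectrum of multiplicity $m$ means that the space is an orthogonal sum of $m$ reducing subspaces on which the operator has simple spectrum and on which its restrictions are pairwise unitarily equivalent. The spectral measure $\sigma$ of $T$ is a finite Borel measure on the unit circle of maximal spectral type for $\widehat T|_H$: it dominates the spectral measures of all vectors of $H$ and is equivalent to the spectral measure of some vector of $H$. Suppose that for some $a\in(0,1)$ and some sequence of natural numbers $k_i\to\infty$ one of the following holds in the weak operator topology on $L_2(X,\mu)$: (a) $\widehat T^{k_i}\to aI+(1-a)\widehat T$; (b) $\widehat T^{k_i}\to (1-a)\sum_{n\ge 0}a^n\widehat T^n$. Then: 1) $\sigma*\sigma\perp\sigma$ for the spectral measure $\sigma$ of $T$ (for every choice of a measure of maximal spectral type); 2) if $T$ has simple spectrum,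 then the automorphism $R(x,y)=(y,Tx)$ of $(X\times X,\mu\otimes\mu)$ has simple spectrum, and $T\times T$ has homogeneous spectrum of multiplicity $2$. -/

import Mathlib

open MeasureTheory Filter Topology
open scoped InnerProductSpace

namespace SpectralErgodic

noncomputable section

/-- The unit circle carries its Borel `σ`-algebra. -/
instance instMeasurableSpaceCircle : MeasurableSpace Circle := borel Circle

instance instBorelSpaceCircle : BorelSpace Circle := ⟨rfl⟩

section UnitaryOperators

variable {K L : Type*} [NormedAddCommGroup K] [InnerProductSpace ℂ K]
  [NormedAddCommGroup L] [InnerProductSpace ℂ L]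

/-- The restriction of a unitary operator `U` to a subspace `S` with `U S = S`. -/
def restrictUnitary (U : K ≃ₗᵢ[ℂ] K) (S : Submodule ℂ K)
    (hS : S.map (U.toLinearEquiv : K →ₗ[ℂ] K) = S) : S ≃ₗᵢ[ℂ] S :=
  (U.submoduleMap S).trans (LinearIsometryEquiv.ofEq _ _ hS)

theorem restrictUnitary_apply (U : K ≃ₗᵢ[ℂ] K) (S : Submodule ℂ K)
    (hS : S.map (U.toLinearEquiv : K →ₗ[ℂ] K) = S) (v : S) :
    (restrictUnitary U S hS v : K) = U v := rfl

/-- Unitary equivalence of two unitary operators. -/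
def UnitarilyEquivalent (U : K ≃ₗᵢ[ℂ] K) (V : L ≃ₗᵢ[ℂ] L) : Prop :=
  ∃ W : K ≃ₗᵢ[ℂ] L, ∀ v, W (U v) = V (W v)

/-- `U` has simple spectrum: there is a cyclic vector `x`, i.e. the closed linear span of
`{Uⁿ x : n ∈ ℤ}` is the whole space. -/
def HasSimpleSpectrum (U : K ≃ₗᵢ[ℂ] K) : Prop :=
  ∃ x : K, (Submodule.span ℂ (Set.range fun n : ℤ => (U ^ n) x)).topologicalClosure = ⊤

/-- `U` has homogeneous spectrum of multiplicity `m`: the space is the orthogonal sum of `m`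
reducing subspaces such that the restrictions of `U` to them have simple spectrum and are
unitarily equivalent to each other. (The summands are automatically closed, being the orthogonal
complements of the sums of the others.) -/
def HasHomogeneousSpectrum (U : K ≃ₗᵢ[ℂ] K) (m : ℕ) : Prop :=
  ∃ (S : Fin m → Submodule ℂ K)
    (hS : ∀ i, (S i).map (U.toLinearEquiv : K →ₗ[ℂ] K) = S i),
    (∀ i j, i ≠ j → S i ⟂ S j) ∧ (⨆ i, S i) = ⊤ ∧
    (∀ i, HasSimpleSpectrum (restrictUnitary U (S i) (hS i))) ∧
    ∀ i j, UnitarilyEquivalent (restrictUnitary U (S i) (hS i)) (restrictUnitary U (S j) (hS j))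

/-- `ν` is the spectral measure of the vector `x`: the finite Borel measure on the unit circle
with Fourier coefficients `⟨Uⁿ x | x⟩ = ∫ zⁿ dν(z)`, `n ∈ ℤ`. (Mathlib's inner product is
conjugate-linear in the first argument.) -/
structure IsSpectralMeasure (U : K ≃ₗᵢ[ℂ] K) (x : K) (ν : Measure Circle) : Prop where
  finite : IsFiniteMeasure ν
  fourier : ∀ n : ℤ, ⟪x, (U ^ n) x⟫_ℂ = ∫ z : Circle, ((z ^ n : Circle) : ℂ) ∂ν

/-- `σ` is a (finite) measure of maximal spectral type of `U`: the spectral measures of all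
vectors are absolutely continuous with respect to `σ`, and `σ` is equivalent to the spectral
measure of some vector. -/
structure IsMaximalSpectralMeasure (U : K ≃ₗᵢ[ℂ] K) (σ : Measure Circle) : Prop where
  finite : IsFiniteMeasure σ
  dominates : ∀ (x : K) (ν : Measure Circle), IsSpectralMeasure U x ν → ν ≪ σ
  attained : ∃ (x : K) (ν : Measure Circle), IsSpectralMeasure U x ν ∧ ν ≪ σ ∧ σ ≪ ν

end UnitaryOperators

section Koopman

variable {X : Type*} [MeasurableSpace X] {μ : Measure X}

/-- The unitary operator `f ↦ f ∘ T` on the complex space `L²(X, μ)`. -/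
def koopman (T : X ≃ᵐ X) (hT : MeasurePreserving T μ μ) : Lp ℂ 2 μ ≃ₗᵢ[ℂ] Lp ℂ 2 μ :=
  LinearIsometryEquiv.ofSurjective (Lp.compMeasurePreservingₗᵢ ℂ T hT) (by
    intro g
    refine ⟨Lp.compMeasurePreserving T.symm (hT.symm T) g, ?_⟩
    apply Lp.ext
    have h1 := Lp.coeFn_compMeasurePreserving
      (Lp.compMeasurePreserving T.symm (hT.symm T) g) hT
    have h2 := hT.quasiMeasurePreserving.ae_eq_comp
      (Lp.coeFn_compMeasurePreserving g (hT.symm T))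
    refine h1.trans (h2.trans ?_)
    filter_upwards with x
    simp)

theorem coeFn_koopman (T : X ≃ᵐ X) (hT : MeasurePreserving T μ μ) (f : Lp ℂ 2 μ) :
    koopman T hT f =ᵐ[μ] f ∘ T :=
  Lp.coeFn_compMeasurePreserving f hT

/-- The space `H` of functions with zero mean: the orthogonal complement of the constants in
`L²(X, μ)`. -/
def meanZero (μ : Measure X) [IsProbabilityMeasure μ] : Submodule ℂ (Lp ℂ 2 μ) :=
  (Submodule.span ℂ {Lp.const 2 μ (1 : ℂ)})ᗮ

theorem koopman_one [IsProbabilityMeasure μ] (T : X ≃ᵐ X) (hT : MeasurePreserving T μ μ) :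
    koopman T hT (Lp.const 2 μ (1 : ℂ)) = Lp.const 2 μ (1 : ℂ) := by
  apply Lp.ext
  refine (coeFn_koopman T hT _).trans ?_
  refine (hT.quasiMeasurePreserving.ae_eq_comp (Lp.coeFn_const 2 μ (1 : ℂ))).trans ?_
  exact (Lp.coeFn_const 2 μ (1 : ℂ)).symm

theorem map_meanZero [IsProbabilityMeasure μ] (T : X ≃ᵐ X) (hT : MeasurePreserving T μ μ) :
    (meanZero μ).map ((koopman T hT).toLinearEquiv : Lp ℂ 2 μ →ₗ[ℂ] Lp ℂ 2 μ) = meanZero μ := by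
  have h := Submodule.map_orthogonal_equiv (Submodule.span ℂ {Lp.const 2 μ (1 : ℂ)})
    (koopman T hT)
  unfold meanZero
  refine h.trans ?_
  rw [Submodule.map_span, Set.image_singleton]
  exact congrArg (fun v => (Submodule.span ℂ {v})ᗮ) (koopman_one T hT)

/-- The unitary operator `f ↦ f ∘ T` on the space of functions with zero mean. The spectrum of
an automorphism is the spectrum of this operator. -/
def koopmanZero [IsProbabilityMeasure μ] (T : X ≃ᵐ X) (hT : MeasurePreserving T μ μ) :
    meanZero μ ≃ₗᵢ[ℂ] meanZero μ :=
  restrictUnitary (koopman T hT) (meanZero μ) (map_meanZero T hT)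

/-- The operator `f ↦ f ∘ T` as an element of the algebra of bounded operators on `L²(X, μ)`. -/
def koopmanCLM (T : X ≃ᵐ X) (hT : MeasurePreserving T μ μ) : Lp ℂ 2 μ →L[ℂ] Lp ℂ 2 μ :=
  (koopman T hT).toContinuousLinearEquiv

/-- Weak operator convergence `Aᵢ → B` of a sequence of bounded operators on `L²(X, μ)`. -/
def WeaklyConverges (A : ℕ → Lp ℂ 2 μ →L[ℂ] Lp ℂ 2 μ) (B : Lp ℂ 2 μ →L[ℂ] Lp ℂ 2 μ) : Prop :=
  ∀ f g : Lp ℂ 2 μ, Tendsto (fun i => ⟪g, A i f⟫_ℂ) atTop (𝓝 ⟪g, B f⟫_ℂ)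

/-- The Cartesian square `T × T`. -/
def square (T : X ≃ᵐ X) : X × X ≃ᵐ X × X := MeasurableEquiv.prodCongr T T

/-- The transformation `R(x, y) = (y, T x)` of `X × X`. -/
def twist (T : X ≃ᵐ X) : X × X ≃ᵐ X × X :=
  (MeasurableEquiv.prodCongr T (MeasurableEquiv.refl X)).trans MeasurableEquiv.prodComm

theorem square_apply (T : X ≃ᵐ X) (p : X × X) : square T p = (T p.1, T p.2) := rfl

theorem twist_apply (T : X ≃ᵐ X) (p : X × X) : twist T p = (p.2, T p.1) := rfl

theorem measurePreserving_square [SFinite μ] (T : X ≃ᵐ X) (hT : MeasurePreserving T μ μ) :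
    MeasurePreserving (square T) (μ.prod μ) (μ.prod μ) :=
  hT.prod hT

theorem measurePreserving_twist [SFinite μ] (T : X ≃ᵐ X) (hT : MeasurePreserving T μ μ) :
    MeasurePreserving (twist T) (μ.prod μ) (μ.prod μ) :=
  Measure.measurePreserving_swap.comp (hT.prod (MeasurePreserving.id μ))

end Koopman

end

end SpectralErgodic

/-! Write `U` for the operator of `T`. Both hypotheses say that `U ^ k i * (1 - b U)` tends weakly
to `e + h U`, where `h b = 0`, `e + h + b = 1` and `0 < e < 1`: in case (a) `(b, e, h) = (0, a, 1 -
a)`, in case (b) `(b, e, h) = (a, 1 - a, 0)`, because `1 - a U` inverts the geometric series. This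
is `HasWeakLimit`, and everything is deduced from it.

Disjointness. For a spectral measure `ν`, the functions `z ^ k i * (1 - b z)` tend weak* to `e + h
z`, and this persists for every finite measure absolutely continuous with respect to `ν`. Suppose
that `ν * ν`, restricted to `A`, is absolutely continuous with respect to `ν`. On the set `z w ∈ A`
of the torus the functions `(z w) ^ k i * (1 - b z) (1 - b w) (1 - b z w)` then have two weak
limits, one found in the variables `z, w` separately and one in the variable `z w`. By
`symbol_identity` they differ by `e (1 - e) (1 - z) (1 - w)` up to sign. By ergodicity `ν` has no
atom at `1`, so the difference is nonzero almost everywhere, and the set is null.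

Multiplicity. Put `L = T ⊗ 1` and `R = 1 ⊗ T`. Weak limits of powers of `T ⊗ T` show that a closed
subspace reducing `T ⊗ T` is invariant under `L + R` (`leftOp_add_rightOp_mem`). It is therefore
invariant under all symmetric polynomials in `L` and `R`, and containing `g ⊗ g` for a cyclic `g`
forces it to contain all symmetrized tensors. If `f` is cyclic for `U`, then `(1 - L) (1 - R)` sends
`f ⊗ 1 + f ⊗ f` to `g ⊗ g` with `g = U f - f`, which is again cyclic by ergodicity. This separates
the part with a constant factor from the rest. For `(x, y) ↦ (y, T x)` the operator itself then
splits the symmetrized tensors; for `T ⊗ T` one gets simple spectrum on the symmetric functions.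

The antisymmetric functions carry an equivalent operator. The operator `L - R` anticommutes with the
exchange of coordinates and commutes with `T ⊗ T`, so its polar decomposition gives the equivalence
once it is injective with dense range. If `L u = R u`, then `T ⊗ T⁻¹` fixes `u`, and the weak limit
for its powers becomes `L u + L⁻¹ u = 2 u`. Hence `L u = u = R u`, and `u = 0` by ergodicity. -/

namespace SpectralErgodic

/-! ### Weak convergence in Hilbert space -/

section WeakConvergence

variable {E : Type*} [NormedAddCommGroup E]

/-- Pointwise convergence of a bounded sequence of functionals can be checked on a total set. -/
theorem tendsto_functional_of_total [NormedSpace ℂ E] {F : ℕ → E →L[ℂ] ℂ} {G : E →L[ℂ] ℂ}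
    {c : ℝ} (hF : ∀ i, ‖F i‖ ≤ c) {s : Set E}
    (hs : (Submodule.span ℂ s).topologicalClosure = ⊤)
    (h : ∀ x ∈ s, Tendsto (fun i => F i x) atTop (𝓝 (G x))) (x : E) :
    Tendsto (fun i => F i x) atTop (𝓝 (G x)) := by
  have hc : 0 ≤ c := (norm_nonneg _).trans (hF 0)
  -- The common norm bound gives equicontinuity, which carries convergence from the dense span to
  -- its closure.
  have heq : Equicontinuous fun i x => F i x := by
    apply UniformEquicontinuous.equicontinuous
    apply LipschitzWith.uniformEquicontinuous _ ⟨c, hc⟩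
    intro i
    exact (F i).lipschitz.weaken (hF i)
  have hspan : ∀ y ∈ Submodule.span ℂ s, Tendsto (fun i => F i y) atTop (𝓝 (G y)) := by
    intro y hy
    induction hy using Submodule.span_induction with
    | mem x hx => exact h x hx
    | zero => simp
    | add x y _ _ hx hy => simpa using hx.add hy
    | smul a x _ hx => simpa using hx.const_mul a
  have hmem : x ∈ closure (Submodule.span ℂ s : Set E) := by
    rw [← Submodule.topologicalClosure_coe, hs]
    trivial
  exact (heq x).tendsto_of_mem_closure (G.continuous.continuousAt.mono_left inf_le_left)
    hspan hmem

variable [InnerProductSpace ℂ E]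

theorem tendsto_inner_of_total {u : ℕ → E} {v : E} {c : ℝ} (hu : ∀ i, ‖u i‖ ≤ c) {s : Set E}
    (hs : (Submodule.span ℂ s).topologicalClosure = ⊤)
    (h : ∀ x ∈ s, Tendsto (fun i => ⟪u i, x⟫_ℂ) atTop (𝓝 ⟪v, x⟫_ℂ)) (x : E) :
    Tendsto (fun i => ⟪u i, x⟫_ℂ) atTop (𝓝 ⟪v, x⟫_ℂ) :=
  tendsto_functional_of_total (F := fun i => innerSL ℂ (u i)) (G := innerSL ℂ v) (c := c)
    (fun i => by simpa using hu i) hs h x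

theorem tendsto_inner_swap {u : ℕ → E} {v x : E} :
    Tendsto (fun i => ⟪u i, x⟫_ℂ) atTop (𝓝 ⟪v, x⟫_ℂ) ↔
      Tendsto (fun i => ⟪x, u i⟫_ℂ) atTop (𝓝 ⟪x, v⟫_ℂ) := by
  constructor <;> intro h
  · simpa only [Function.comp_def, inner_conj_symm] using
      (Complex.continuous_conj.tendsto _).comp h
  · simpa only [Function.comp_def, inner_conj_symm] using
      (Complex.continuous_conj.tendsto _).comp h

/-- Weak convergence of a bounded sequence of operators can be checked on a total set. -/
theorem tendsto_inner_apply_of_total {A : ℕ → E →L[ℂ] E} {B : E →L[ℂ] E} {c : ℝ}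
    (hA : ∀ i, ‖A i‖ ≤ c) {s : Set E} (hs : (Submodule.span ℂ s).topologicalClosure = ⊤)
    (h : ∀ x ∈ s, ∀ y ∈ s, Tendsto (fun i => ⟪y, A i x⟫_ℂ) atTop (𝓝 ⟪y, B x⟫_ℂ)) (x y : E) :
    Tendsto (fun i => ⟪y, A i x⟫_ℂ) atTop (𝓝 ⟪y, B x⟫_ℂ) := by
  have hc : 0 ≤ c := (norm_nonneg _).trans (hA 0)
  have h1 : ∀ y ∈ s, ∀ x, Tendsto (fun i => ⟪y, A i x⟫_ℂ) atTop (𝓝 ⟪y, B x⟫_ℂ) := by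
    intro y hy
    refine tendsto_functional_of_total (F := fun i => (innerSL ℂ y).comp (A i))
      (G := (innerSL ℂ y).comp B) (c := ‖y‖ * c) (fun i => ?_) hs (fun x hx => h x hx y hy)
    refine (ContinuousLinearMap.opNorm_comp_le _ _).trans ?_
    rw [innerSL_apply_norm]
    exact mul_le_mul_of_nonneg_left (hA i) (norm_nonneg _)
  rw [← tendsto_inner_swap]
  refine tendsto_inner_of_total (c := c * ‖x‖) (fun i => ?_) hs (fun y hy => ?_) y
  · exact (A i).le_of_opNorm_le (hA i) x
  · rw [tendsto_inner_swap]
    exact h1 y hy x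

variable [CompleteSpace E]

theorem span_closure_eq_top_iff {s : Set E} :
    (Submodule.span ℂ s).topologicalClosure = ⊤ ↔ ∀ x, (∀ y ∈ s, ⟪y, x⟫_ℂ = 0) → x = 0 := by
  rw [Submodule.topologicalClosure_eq_top_iff, Submodule.eq_bot_iff]
  refine forall_congr' fun x => ?_
  rw [Submodule.mem_orthogonal]
  constructor
  · intro h hx
    apply h
    intro u hu
    induction hu using Submodule.span_induction with
    | mem x hx' => exact hx x hx'
    | zero => simp
    | add x y _ _ hx hy => simp [inner_add_left, hx, hy]
    | smul a x _ hx => simp [inner_smul_left, hx]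
  · intro h hx
    exact h fun y hy => hx y (Submodule.subset_span hy)

theorem hasSimpleSpectrum_iff {U : E ≃ₗᵢ[ℂ] E} :
    HasSimpleSpectrum U ↔ ∃ x, ∀ y, (∀ n : ℤ, ⟪(U ^ n) x, y⟫_ℂ = 0) → y = 0 := by
  unfold HasSimpleSpectrum
  simp only [span_closure_eq_top_iff, Set.forall_mem_range]

/-- A closed subspace is weakly closed. -/
theorem mem_of_tendsto_inner {C : Submodule ℂ E} (hC : IsClosed (C : Set E)) {u : ℕ → E} {v : E}
    (hu : ∀ i, u i ∈ C) (h : ∀ y, Tendsto (fun i => ⟪y, u i⟫_ℂ) atTop (𝓝 ⟪y, v⟫_ℂ)) : v ∈ C := by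
  have : CompleteSpace C := hC.completeSpace_coe
  rw [← Submodule.orthogonal_orthogonal C, Submodule.mem_orthogonal]
  intro y hy
  refine tendsto_nhds_unique (h y) ?_
  simp [Submodule.inner_left_of_mem_orthogonal (hu _) hy]

/-- Let `Sᵢ D → c` weakly, where `D` is surjective and `c ≠ 0`. If a closed subspace and
its orthogonal complement are invariant under all `Sᵢ`, then the subspace is invariant
under `D`. -/
theorem apply_mem_of_tendsto_smul {C : Submodule ℂ E} (hC : IsClosed (C : Set E))
    {S : ℕ → E →L[ℂ] E} (hS : ∀ i, ∀ x ∈ C, S i x ∈ C) (hS' : ∀ i, ∀ x ∈ Cᗮ, S i x ∈ Cᗮ)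
    {D : E →L[ℂ] E} (hD : Function.Surjective D) {c : ℂ} (hc : c ≠ 0)
    (h : ∀ x y, Tendsto (fun i => ⟪y, S i (D x)⟫_ℂ) atTop (𝓝 ⟪y, c • x⟫_ℂ)) {x : E}
    (hx : x ∈ C) : D x ∈ C := by
  have : CompleteSpace C := hC.completeSpace_coe
  -- Split `D x = z + z'` along `C` and `Cᗮ`, and write `z = D w`, so that `z' = D (x - w)`. The
  -- limits put `c • w` in `C` and `c • (x - w)` in `Cᗮ`, hence `x - w` lies in both and vanishes.
  obtain ⟨z, hz, z', hz', hzz⟩ := Submodule.exists_add_mem_mem_orthogonal (K := C) (D x)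
  obtain ⟨w, rfl⟩ := hD z
  have hw : w ∈ C := by
    have := mem_of_tendsto_inner hC (fun i => hS i _ hz) (h w)
    exact (Submodule.smul_mem_iff _ hc).1 this
  have hw' : x - w ∈ Cᗮ := by
    have h1 : D (x - w) ∈ Cᗮ := by rw [map_sub, hzz, add_sub_cancel_left]; exact hz'
    have := mem_of_tendsto_inner (Submodule.isClosed_orthogonal C) (fun i => hS' i _ h1)
      (h (x - w))
    exact (Submodule.smul_mem_iff _ hc).1 this
  have h0 : x - w = 0 := by
    have := Submodule.inner_right_of_mem_orthogonal (C.sub_mem hx hw) hw'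
    exact inner_self_eq_zero.1 this
  rw [sub_eq_zero.1 h0]
  exact hz

end WeakConvergence

/-! ### Unitary equivalence and polar decomposition -/

section Polar

variable {E F : Type*} [NormedAddCommGroup E] [InnerProductSpace ℂ E]
  [NormedAddCommGroup F] [InnerProductSpace ℂ F]

theorem UnitarilyEquivalent.refl (U : E ≃ₗᵢ[ℂ] E) : UnitarilyEquivalent U U :=
  ⟨LinearIsometryEquiv.refl ℂ E, fun _ => rfl⟩

theorem UnitarilyEquivalent.symm {U : E ≃ₗᵢ[ℂ] E} {V : F ≃ₗᵢ[ℂ] F}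
    (h : UnitarilyEquivalent U V) : UnitarilyEquivalent V U := by
  obtain ⟨W, hW⟩ := h
  refine ⟨W.symm, fun v => ?_⟩
  rw [LinearIsometryEquiv.symm_apply_eq, hW, LinearIsometryEquiv.apply_symm_apply]

variable [CompleteSpace F]

/-- The hypothesis says that the orthogonal complement of the range, which is the kernel of the
adjoint, is trivial. -/
theorem denseRange_of_adjoint_injective (B : E →L[ℂ] F)
    (h : ∀ y, (∀ x, ⟪B x, y⟫_ℂ = 0) → y = 0) : DenseRange B := by
  have h1 : (LinearMap.range (B : E →ₗ[ℂ] F)).topologicalClosure = ⊤ := by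
    rw [Submodule.topologicalClosure_eq_top_iff, Submodule.eq_bot_iff]
    intro y hy
    apply h
    intro x
    exact (Submodule.mem_orthogonal _ _).1 hy _ ⟨x, rfl⟩
  have h2 := Submodule.dense_iff_topologicalClosure_eq_top.2 h1
  rwa [LinearMap.coe_range] at h2

variable [CompleteSpace E]

/-- If an injective operator with dense range intertwines two unitary operators, then they are
unitarily equivalent (by the unitary part of its polar decomposition). -/
theorem UnitarilyEquivalent.of_intertwining {U : E ≃ₗᵢ[ℂ] E} {V : F ≃ₗᵢ[ℂ] F} (B : E →L[ℂ] F)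
    (hB : ∀ x, B (U x) = V (B x)) (hinj : ∀ x, B x = 0 → x = 0) (hrange : DenseRange B) :
    UnitarilyEquivalent U V := by
  let Bs : F →L[ℂ] E := ContinuousLinearMap.adjoint B
  let Q : E →L[ℂ] E := Bs ∘L B
  have hQ : 0 ≤ Q := by
    rw [ContinuousLinearMap.nonneg_iff_isPositive]
    exact ContinuousLinearMap.isPositive_adjoint_comp_self B
  -- Since `‖P x‖ = ‖B x‖`, the map `P x ↦ B x` is isometric between dense subspaces and extends to
  -- the required unitary operator `W`.
  let P : E →L[ℂ] E := CFC.sqrt Q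
  have hPpos : 0 ≤ P := CFC.sqrt_nonneg Q
  have hPP : P * P = Q := CFC.sqrt_mul_sqrt_self Q hQ
  have hPsa : ∀ x y, ⟪P x, y⟫_ℂ = ⟪x, P y⟫_ℂ := by
    have h := ((ContinuousLinearMap.nonneg_iff_isPositive P).1 hPpos).isSelfAdjoint
    intro x y
    rw [← ContinuousLinearMap.adjoint_inner_right, h.adjoint_eq]
  have hnorm : ∀ x, ‖P x‖ = ‖B x‖ := by
    intro x
    have h : ⟪P x, P x⟫_ℂ = ⟪B x, B x⟫_ℂ := by
      rw [hPsa, ← ContinuousLinearMap.adjoint_inner_right]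
      exact congrArg (fun A : E →L[ℂ] E => ⟪x, A x⟫_ℂ) hPP
    rw [inner_self_eq_norm_sq_to_K, inner_self_eq_norm_sq_to_K] at h
    have h' : ‖P x‖ ^ 2 = ‖B x‖ ^ 2 := by exact_mod_cast h
    exact (sq_eq_sq₀ (norm_nonneg _) (norm_nonneg _)).1 h'
  have hPdense : DenseRange P := by
    refine denseRange_of_adjoint_injective P fun y hy => hinj y ?_
    rw [← norm_eq_zero, ← hnorm, norm_eq_zero, ← inner_self_eq_zero (𝕜 := ℂ), ← hPsa]
    exact hy (P y)
  let Uc : E →L[ℂ] E := U.toContinuousLinearEquiv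
  have hBs : ∀ y, Bs (V y) = U (Bs y) := by
    intro y
    refine ext_inner_left ℂ fun x => ?_
    obtain ⟨x, rfl⟩ := U.surjective x
    rw [ContinuousLinearMap.adjoint_inner_right, hB, V.inner_map_map, U.inner_map_map,
      ContinuousLinearMap.adjoint_inner_right]
  have hQU : Commute Q Uc := by
    ext x
    change Bs (B (U x)) = U (Bs (B x))
    rw [hB, hBs]
  -- The operator `P` is a function of `Q`, so whatever commutes with `Q` commutes with `P`.
  have hPU : Commute P Uc := by
    have : Commute Uc Q := hQU.symm
    exact (hQU.cfcₙ_nnreal _)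
  have hPU' : ∀ x, P (U x) = U (P x) := fun x => congrArg (fun A : E →L[ℂ] E => A x) hPU
  let W : E ≃ₗᵢ[ℂ] F := (LinearEquiv.refl ℂ E).extendOfIsometry (P : E →ₗ[ℂ] E)
    (B : E →ₗ[ℂ] F) hPdense hrange (fun x => (hnorm x).symm)
  have hW : ∀ x, W (P x) = B x := fun x =>
    LinearEquiv.extendOfIsometry_eq (LinearEquiv.refl ℂ E) (P : E →ₗ[ℂ] E) (B : E →ₗ[ℂ] F)
      hPdense hrange (fun x => (hnorm x).symm) x
  refine ⟨W, fun v => ?_⟩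
  refine hPdense.induction_on (p := fun v => W (U v) = V (W v)) v ?_ ?_
  · exact isClosed_eq (W.continuous.comp U.continuous) (V.continuous.comp W.continuous)
  · intro x
    rw [← hPU', hW, hW, hB]

theorem HasSimpleSpectrum.of_unitarilyEquivalent {U : E ≃ₗᵢ[ℂ] E} {V : F ≃ₗᵢ[ℂ] F}
    (hU : HasSimpleSpectrum U) (h : UnitarilyEquivalent U V) : HasSimpleSpectrum V := by
  obtain ⟨W, hW⟩ := h
  rw [hasSimpleSpectrum_iff] at hU ⊢
  obtain ⟨x, hx⟩ := hU
  have hsymm : ∀ v, W (U⁻¹ v) = V⁻¹ (W v) := by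
    intro v
    have := hW (U⁻¹ v)
    rw [show U (U⁻¹ v) = v from U.apply_symm_apply v] at this
    rw [this]
    exact (V.symm_apply_apply _).symm
  have hpow : ∀ n : ℤ, ∀ v, W ((U ^ n) v) = (V ^ n) (W v) := by
    intro n
    induction n using Int.induction_on with
    | zero => intro v; rfl
    | succ n ih =>
      intro v
      rw [zpow_add_one, zpow_add_one]
      exact (ih (U v)).trans (by rw [hW]; rfl)
    | pred n ih => 
      intro v; rw [zpow_sub_one, zpow_sub_one]
      exact (ih (U⁻¹ v)).trans (by rw [hsymm]; rfl)
  refine ⟨W x, fun y hy => ?_⟩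
  obtain ⟨y, rfl⟩ := W.surjective y
  rw [hx y fun n => ?_, map_zero]
  rw [← W.inner_map_map, hpow]
  exact hy n

end Polar

end SpectralErgodic

namespace SpectralErgodic

noncomputable section

/-! ### Tensor products in the L² space of a product -/

section Tensor

variable {X Y : Type*} [MeasurableSpace X] [MeasurableSpace Y] {μ : Measure X} {ν : Measure Y}

/-- An integrable function whose integrals over all measurable rectangles vanish is zero. -/
theorem ae_eq_zero_of_setIntegral_prod_eq_zero {u : X × Y → ℂ} (hu : Integrable u (μ.prod ν))
    (h : ∀ s t, MeasurableSet s → MeasurableSet t → ∫ p in s ×ˢ t, u p ∂(μ.prod ν) = 0) :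
    u =ᵐ[μ.prod ν] 0 := by
  suffices H : ∀ E, MeasurableSet E → ∫ p in E, u p ∂(μ.prod ν) = 0 from
    hu.ae_eq_zero_of_forall_setIntegral_eq_zero fun E hE _ => H E hE
  intro E hE
  induction E, hE using MeasurableSpace.induction_on_inter generateFrom_prod.symm
    isPiSystem_prod with
  | empty => simp
  | basic E hE =>
    obtain ⟨s, hs, t, ht, rfl⟩ := hE
    exact h s t hs ht
  | compl E hE ih =>
    have huniv := h Set.univ Set.univ MeasurableSet.univ MeasurableSet.univ
    rw [Set.univ_prod_univ, setIntegral_univ] at huniv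
    have := integral_add_compl hE hu
    rwa [ih, huniv, zero_add] at this
  | iUnion E hd hE ih =>
    rw [integral_iUnion hE hd hu.integrableOn]
    simp [ih]

theorem memLp_two_mul_prod {f : X → ℂ} {g : Y → ℂ} (hf : MemLp f 2 μ) (hg : MemLp g 2 ν) :
    MemLp (fun p : X × Y => f p.1 * g p.2) 2 (μ.prod ν) := by
  have hm : AEStronglyMeasurable (fun p : X × Y => f p.1 * g p.2) (μ.prod ν) :=
    hf.1.comp_fst.mul hg.1.comp_snd
  rw [memLp_two_iff_integrable_sq_norm hm]
  have h := ((memLp_two_iff_integrable_sq_norm hf.1).1 hf).mul_prod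
    ((memLp_two_iff_integrable_sq_norm hg.1).1 hg)
  refine h.congr (Eventually.of_forall fun p => ?_)
  simp [mul_pow]

/-- The function `(x, y) ↦ f x * g y` as an element of `L²`. -/
def tensorFun (f : Lp ℂ 2 μ) (g : Lp ℂ 2 ν) : Lp ℂ 2 (μ.prod ν) :=
  (memLp_two_mul_prod (Lp.memLp f) (Lp.memLp g)).toLp _

theorem coeFn_tensorFun (f : Lp ℂ 2 μ) (g : Lp ℂ 2 ν) :
    tensorFun f g =ᵐ[μ.prod ν] fun p => f p.1 * g p.2 :=
  MemLp.coeFn_toLp _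

theorem tensorFun_ext {f : Lp ℂ 2 μ} {g : Lp ℂ 2 ν} {u : Lp ℂ 2 (μ.prod ν)} {f' : X → ℂ}
    {g' : Y → ℂ} (hf : f =ᵐ[μ] f') (hg : g =ᵐ[ν] g')
    (h : u =ᵐ[μ.prod ν] fun p => f' p.1 * g' p.2) : tensorFun f g = u := by
  apply Lp.ext
  refine (coeFn_tensorFun f g).trans (EventuallyEq.trans ?_ h.symm)
  have h1 := Measure.quasiMeasurePreserving_fst (μ := μ) (ν := ν) |>.ae_eq_comp hf
  have h2 := Measure.quasiMeasurePreserving_snd (μ := μ) (ν := ν) |>.ae_eq_comp hg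
  filter_upwards [h1, h2] with p h1 h2
  simp only [Function.comp] at h1 h2
  rw [h1, h2]

variable [IsFiniteMeasure μ] [IsFiniteMeasure ν]

theorem inner_tensorFun (f f' : Lp ℂ 2 μ) (g g' : Lp ℂ 2 ν) :
    ⟪tensorFun f g, tensorFun f' g'⟫_ℂ = ⟪f, f'⟫_ℂ * ⟪g, g'⟫_ℂ := by
  rw [L2.inner_def, L2.inner_def, L2.inner_def, ← integral_prod_mul]
  apply integral_congr_ae
  filter_upwards [coeFn_tensorFun f g, coeFn_tensorFun f' g'] with p h h'
  rw [h, h']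
  simp only [RCLike.inner_apply, map_mul]
  ring

theorem norm_tensorFun (f : Lp ℂ 2 μ) (g : Lp ℂ 2 ν) : ‖tensorFun f g‖ = ‖f‖ * ‖g‖ := by
  have h := inner_tensorFun f f g g
  simp only [inner_self_eq_norm_sq_to_K] at h
  have h' : ‖tensorFun f g‖ ^ 2 = (‖f‖ * ‖g‖) ^ 2 := by
    rw [mul_pow]
    exact_mod_cast h
  exact (sq_eq_sq₀ (norm_nonneg _) (by positivity)).1 h'

/-- The bounded bilinear map `(f, g) ↦ f ⊗ g`. -/
def tensor : Lp ℂ 2 μ →L[ℂ] Lp ℂ 2 ν →L[ℂ] Lp ℂ 2 (μ.prod ν) :=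
  LinearMap.mkContinuous₂ (LinearMap.mk₂ ℂ tensorFun
    (fun f f' g => by
      refine tensorFun_ext (Lp.coeFn_add f f') (EventuallyEq.refl _ _) ?_
      refine (Lp.coeFn_add _ _).trans ?_
      filter_upwards [coeFn_tensorFun f g, coeFn_tensorFun f' g] with p h h'
      simp [h, h', add_mul])
    (fun c f g => by
      refine tensorFun_ext (Lp.coeFn_smul c f) (EventuallyEq.refl _ _) ?_
      refine (Lp.coeFn_smul _ _).trans ?_
      filter_upwards [coeFn_tensorFun f g] with p h
      simp [h, mul_assoc])
    (fun f g g' => by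
      refine tensorFun_ext (EventuallyEq.refl _ _) (Lp.coeFn_add g g') ?_
      refine (Lp.coeFn_add _ _).trans ?_
      filter_upwards [coeFn_tensorFun f g, coeFn_tensorFun f g'] with p h h'
      simp [h, h', mul_add])
    (fun c f g => by
      refine tensorFun_ext (EventuallyEq.refl _ _) (Lp.coeFn_smul c g) ?_
      refine (Lp.coeFn_smul _ _).trans ?_
      filter_upwards [coeFn_tensorFun f g] with p h
      simp [h, mul_left_comm]))
    1 (fun f g => by rw [one_mul]; exact (norm_tensorFun f g).le)

theorem coeFn_tensor (f : Lp ℂ 2 μ) (g : Lp ℂ 2 ν) :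
    tensor f g =ᵐ[μ.prod ν] fun p => f p.1 * g p.2 :=
  coeFn_tensorFun f g

theorem tensor_ext {f : Lp ℂ 2 μ} {g : Lp ℂ 2 ν} {u : Lp ℂ 2 (μ.prod ν)} {f' : X → ℂ}
    {g' : Y → ℂ} (hf : f =ᵐ[μ] f') (hg : g =ᵐ[ν] g')
    (h : u =ᵐ[μ.prod ν] fun p => f' p.1 * g' p.2) : tensor f g = u :=
  tensorFun_ext hf hg h

theorem inner_tensor (f f' : Lp ℂ 2 μ) (g g' : Lp ℂ 2 ν) :
    ⟪tensor f g, tensor f' g'⟫_ℂ = ⟪f, f'⟫_ℂ * ⟪g, g'⟫_ℂ :=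
  inner_tensorFun f f' g g'

theorem norm_tensor (f : Lp ℂ 2 μ) (g : Lp ℂ 2 ν) : ‖tensor f g‖ = ‖f‖ * ‖g‖ :=
  norm_tensorFun f g

/-- Indicators of rectangles are tensors of indicators, so the integrals of `u` over all rectangles
vanish. -/
theorem eq_zero_of_inner_tensor_eq_zero {u : Lp ℂ 2 (μ.prod ν)}
    (h : ∀ (f : Lp ℂ 2 μ) (g : Lp ℂ 2 ν), ⟪tensor f g, u⟫_ℂ = 0) : u = 0 := by
  rw [Lp.eq_zero_iff_ae_eq_zero]
  refine ae_eq_zero_of_setIntegral_prod_eq_zero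
    ((Lp.memLp u).integrable (by norm_num)) fun s t hs ht => ?_
  have h1 := h (indicatorConstLp 2 hs (measure_ne_top μ s) 1)
    (indicatorConstLp 2 ht (measure_ne_top ν t) 1)
  have h2 : tensor (indicatorConstLp 2 hs (measure_ne_top μ s) 1)
      (indicatorConstLp 2 ht (measure_ne_top ν t) 1) =
      indicatorConstLp 2 (hs.prod ht) (measure_ne_top (μ.prod ν) _) (1 : ℂ) := by
    refine tensor_ext indicatorConstLp_coeFn indicatorConstLp_coeFn ?_
    refine indicatorConstLp_coeFn.trans (Eventually.of_forall fun p => ?_)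
    by_cases h1 : p.1 ∈ s <;> by_cases h2 : p.2 ∈ t <;> simp [Set.indicator, h1, h2]
  rwa [h2, L2.inner_indicatorConstLp_one] at h1

theorem span_tensor_closure_eq_top :
    (Submodule.span ℂ {u : Lp ℂ 2 (μ.prod ν) | ∃ f g, u = tensor f g}).topologicalClosure
      = ⊤ := by
  rw [span_closure_eq_top_iff]
  intro u hu
  exact eq_zero_of_inner_tensor_eq_zero fun f g => hu _ ⟨f, g, rfl⟩

theorem ext_tensor {F : Type*} [NormedAddCommGroup F] [NormedSpace ℂ F]
    {A B : Lp ℂ 2 (μ.prod ν) →L[ℂ] F} (h : ∀ f g, A (tensor f g) = B (tensor f g)) : A = B := by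
  refine ContinuousLinearMap.ext_on ?_ (s := {u | ∃ f g, u = tensor f g}) ?_
  · exact Submodule.dense_iff_topologicalClosure_eq_top.2 span_tensor_closure_eq_top
  · rintro _ ⟨f, g, rfl⟩
    exact h f g

/-- Weak limits of tensor products of vectors. -/
theorem tendsto_inner_tensor {u : ℕ → Lp ℂ 2 μ} {u₀ : Lp ℂ 2 μ} {v : ℕ → Lp ℂ 2 ν}
    {v₀ : Lp ℂ 2 ν} {c d : ℝ} (hu : ∀ i, ‖u i‖ ≤ c) (hv : ∀ i, ‖v i‖ ≤ d)
    (hu₀ : ∀ x, Tendsto (fun i => ⟪u i, x⟫_ℂ) atTop (𝓝 ⟪u₀, x⟫_ℂ))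
    (hv₀ : ∀ x, Tendsto (fun i => ⟪v i, x⟫_ℂ) atTop (𝓝 ⟪v₀, x⟫_ℂ)) (x : Lp ℂ 2 (μ.prod ν)) :
    Tendsto (fun i => ⟪tensor (u i) (v i), x⟫_ℂ) atTop (𝓝 ⟪tensor u₀ v₀, x⟫_ℂ) := by
  refine tendsto_inner_of_total (c := c * d) (fun i => ?_) span_tensor_closure_eq_top ?_ x
  · rw [norm_tensor]
    exact mul_le_mul (hu i) (hv i) (norm_nonneg _) ((norm_nonneg _).trans (hu i))
  · rintro _ ⟨f, g, rfl⟩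
    simp only [inner_tensor]
    exact (hu₀ f).mul (hv₀ g)

/-- Weak limits of tensor products of operators. -/
theorem tendsto_inner_tensor_apply {A : ℕ → Lp ℂ 2 μ →L[ℂ] Lp ℂ 2 μ}
    {A₀ : Lp ℂ 2 μ →L[ℂ] Lp ℂ 2 μ} {B : ℕ → Lp ℂ 2 ν →L[ℂ] Lp ℂ 2 ν}
    {B₀ : Lp ℂ 2 ν →L[ℂ] Lp ℂ 2 ν}
    {M : ℕ → Lp ℂ 2 (μ.prod ν) →L[ℂ] Lp ℂ 2 (μ.prod ν)}
    {M₀ : Lp ℂ 2 (μ.prod ν) →L[ℂ] Lp ℂ 2 (μ.prod ν)} {c : ℝ} (hM : ∀ i, ‖M i‖ ≤ c)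
    (hAB : ∀ i f g, M i (tensor f g) = tensor (A i f) (B i g))
    (hAB₀ : ∀ f g, M₀ (tensor f g) = tensor (A₀ f) (B₀ g))
    (hA : ∀ x y, Tendsto (fun i => ⟪y, A i x⟫_ℂ) atTop (𝓝 ⟪y, A₀ x⟫_ℂ))
    (hB : ∀ x y, Tendsto (fun i => ⟪y, B i x⟫_ℂ) atTop (𝓝 ⟪y, B₀ x⟫_ℂ))
    (x y : Lp ℂ 2 (μ.prod ν)) :
    Tendsto (fun i => ⟪y, M i x⟫_ℂ) atTop (𝓝 ⟪y, M₀ x⟫_ℂ) := by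
  refine tendsto_inner_apply_of_total hM span_tensor_closure_eq_top ?_ x y
  rintro _ ⟨f, g, rfl⟩ _ ⟨f', g', rfl⟩
  simp only [hAB, hAB₀, inner_tensor]
  exact (hA f f').mul (hB g g')

end Tensor

/-! ### Action of the product transformations on tensors -/

section KoopmanTensor

variable {X : Type*} [MeasurableSpace X] {μ : Measure X} [IsFiniteMeasure μ]

theorem koopman_twist_tensor (T : X ≃ᵐ X) (hT : MeasurePreserving T μ μ) (f g : Lp ℂ 2 μ) :
    koopman (twist T) (measurePreserving_twist T hT) (tensor f g) =
      tensor (koopman T hT g) f := by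
  refine (tensor_ext (coeFn_koopman T hT g) (EventuallyEq.refl _ _) ?_).symm
  refine (coeFn_koopman _ _ _).trans ?_
  refine ((measurePreserving_twist T hT).quasiMeasurePreserving.ae_eq_comp
    (coeFn_tensor f g)).trans (Eventually.of_forall fun p => ?_)
  simp [twist_apply, mul_comm]

theorem koopman_square_tensor (T : X ≃ᵐ X) (hT : MeasurePreserving T μ μ) (f g : Lp ℂ 2 μ) :
    koopman (square T) (measurePreserving_square T hT) (tensor f g) =
      tensor (koopman T hT f) (koopman T hT g) := by
  refine (tensor_ext (coeFn_koopman T hT f) (coeFn_koopman T hT g) ?_).symm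
  refine (coeFn_koopman _ _ _).trans ?_
  refine ((measurePreserving_square T hT).quasiMeasurePreserving.ae_eq_comp
    (coeFn_tensor f g)).trans (Eventually.of_forall fun p => ?_)
  simp [square_apply]

variable (μ) in
theorem measurePreserving_prodComm :
    MeasurePreserving (MeasurableEquiv.prodComm : X × X ≃ᵐ X × X) (μ.prod μ) (μ.prod μ) :=
  Measure.measurePreserving_swap

variable (μ) in
/-- The operator of exchange of coordinates in `L²(X × X)`. -/
def swapOp : Lp ℂ 2 (μ.prod μ) ≃ₗᵢ[ℂ] Lp ℂ 2 (μ.prod μ) :=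
  koopman MeasurableEquiv.prodComm (measurePreserving_prodComm μ)

theorem swapOp_tensor (f g : Lp ℂ 2 μ) : swapOp μ (tensor f g) = tensor g f := by
  refine (tensor_ext (EventuallyEq.refl _ _) (EventuallyEq.refl _ _) ?_).symm
  refine (coeFn_koopman _ _ _).trans ?_
  refine ((measurePreserving_prodComm μ).quasiMeasurePreserving.ae_eq_comp
    (coeFn_tensor f g)).trans (Eventually.of_forall fun p => ?_)
  simp [MeasurableEquiv.prodComm, mul_comm]

theorem measurePreserving_fst_coord (T : X ≃ᵐ X) (hT : MeasurePreserving T μ μ) :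
    MeasurePreserving (MeasurableEquiv.prodCongr T (MeasurableEquiv.refl X)) (μ.prod μ)
      (μ.prod μ) :=
  hT.prod (MeasurePreserving.id μ)

/-- The operator `T ⊗ 1`. -/
def leftOp (T : X ≃ᵐ X) (hT : MeasurePreserving T μ μ) :
    Lp ℂ 2 (μ.prod μ) ≃ₗᵢ[ℂ] Lp ℂ 2 (μ.prod μ) :=
  koopman (MeasurableEquiv.prodCongr T (MeasurableEquiv.refl X))
    (measurePreserving_fst_coord T hT)

theorem leftOp_tensor (T : X ≃ᵐ X) (hT : MeasurePreserving T μ μ) (f g : Lp ℂ 2 μ) :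
    leftOp T hT (tensor f g) = tensor (koopman T hT f) g := by
  refine (tensor_ext (coeFn_koopman T hT f) (EventuallyEq.refl _ _) ?_).symm
  refine (coeFn_koopman _ _ _).trans ?_
  refine ((measurePreserving_fst_coord T hT).quasiMeasurePreserving.ae_eq_comp
    (coeFn_tensor f g)).trans (Eventually.of_forall fun p => ?_)
  simp [MeasurableEquiv.prodCongr]

theorem measurePreserving_snd_coord (T : X ≃ᵐ X) (hT : MeasurePreserving T μ μ) :
    MeasurePreserving (MeasurableEquiv.prodCongr (MeasurableEquiv.refl X) T) (μ.prod μ)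
      (μ.prod μ) :=
  (MeasurePreserving.id μ).prod hT

/-- The operator `1 ⊗ T`. -/
def rightOp (T : X ≃ᵐ X) (hT : MeasurePreserving T μ μ) :
    Lp ℂ 2 (μ.prod μ) ≃ₗᵢ[ℂ] Lp ℂ 2 (μ.prod μ) :=
  koopman (MeasurableEquiv.prodCongr (MeasurableEquiv.refl X) T)
    (measurePreserving_snd_coord T hT)

theorem rightOp_tensor (T : X ≃ᵐ X) (hT : MeasurePreserving T μ μ) (f g : Lp ℂ 2 μ) :
    rightOp T hT (tensor f g) = tensor f (koopman T hT g) := by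
  refine (tensor_ext (EventuallyEq.refl _ _) (coeFn_koopman T hT g) ?_).symm
  refine (coeFn_koopman _ _ _).trans ?_
  refine ((measurePreserving_snd_coord T hT).quasiMeasurePreserving.ae_eq_comp
    (coeFn_tensor f g)).trans (Eventually.of_forall fun p => ?_)
  simp [MeasurableEquiv.prodCongr]

end KoopmanTensor

end

end SpectralErgodic

namespace SpectralErgodic

noncomputable section

/-! ### Unitary operators as bounded operators; the common hypothesis -/

section UnitaryCLM

variable {E : Type*} [NormedAddCommGroup E] [InnerProductSpace ℂ E]

/-- A unitary operator as a bounded operator. -/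
def unitaryCLM (U : E ≃ₗᵢ[ℂ] E) : E →L[ℂ] E := U.toContinuousLinearEquiv

@[simp]
theorem unitaryCLM_apply (U : E ≃ₗᵢ[ℂ] E) (x : E) : unitaryCLM U x = U x := rfl

theorem norm_unitaryCLM_le (U : E ≃ₗᵢ[ℂ] E) : ‖unitaryCLM U‖ ≤ 1 :=
  ContinuousLinearMap.opNorm_le_bound _ zero_le_one fun x => by simp

theorem unitaryCLM_pow (U : E ≃ₗᵢ[ℂ] E) (n : ℕ) : unitaryCLM U ^ n = unitaryCLM (U ^ n) := by
  induction n with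
  | zero => rfl
  | succ n ih => rw [pow_succ, ih, pow_succ]; rfl

theorem zpow_succ_apply (U : E ≃ₗᵢ[ℂ] E) (n : ℤ) (x : E) :
    (U ^ (n + 1)) x = U ((U ^ n) x) := by
  rw [add_comm, zpow_add, zpow_one]
  rfl

theorem zpow_succ_apply' (U : E ≃ₗᵢ[ℂ] E) (n : ℤ) (x : E) :
    (U ^ (n + 1)) x = (U ^ n) (U x) := by
  rw [zpow_add, zpow_one]
  rfl

theorem apply_inv_self (U : E ≃ₗᵢ[ℂ] E) (x : E) : U (U⁻¹ x) = x := U.apply_symm_apply x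

theorem inv_apply_self (U : E ≃ₗᵢ[ℂ] E) (x : E) : U⁻¹ (U x) = x := U.symm_apply_apply x

theorem inner_inv_left (U : E ≃ₗᵢ[ℂ] E) (x y : E) : ⟪U⁻¹ x, y⟫_ℂ = ⟪x, U y⟫_ℂ := by
  rw [← U.inner_map_map, apply_inv_self]

theorem zpow_mem {U : E ≃ₗᵢ[ℂ] E} {C : Submodule ℂ E} (h : ∀ x ∈ C, U x ∈ C)
    (h' : ∀ x ∈ C, U⁻¹ x ∈ C) (n : ℤ) : ∀ x ∈ C, (U ^ n) x ∈ C := by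
  induction n using Int.induction_on with
  | zero => exact fun x hx => hx
  | succ n ih => intro x hx; rw [zpow_add_one]; exact ih _ (h x hx)
  | pred n ih => intro x hx; rw [zpow_sub_one]; exact ih _ (h' x hx)

variable [CompleteSpace E]

/-- Neumann series: the norm of `b • U` is less than one. -/
theorem surjective_one_sub_smul (U : E ≃ₗᵢ[ℂ] E) {b : ℂ} (hb : ‖b‖ < 1) :
    Function.Surjective (1 - b • unitaryCLM U : E →L[ℂ] E) := by
  have h : ‖b • unitaryCLM U‖ < 1 := by
    rw [norm_smul]
    exact (mul_le_of_le_one_right (norm_nonneg _) (norm_unitaryCLM_le U)).trans_lt hb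
  obtain ⟨v, hv⟩ := isUnit_one_sub_of_norm_lt_one h
  intro x
  refine ⟨(↑v⁻¹ : E →L[ℂ] E) x, ?_⟩
  rw [← hv]
  exact congrArg (fun A : E →L[ℂ] E => A x) v.mul_inv

/-- The common form of the two hypotheses `Uᵏⁱ → a + (1 - a) U` and
`Uᵏⁱ → (1 - a) ∑ aⁿ Uⁿ`: the operators `Uᵏⁱ (1 - b U)` converge weakly to `e + h U`. -/
structure HasWeakLimit (U : E ≃ₗᵢ[ℂ] E) (k : ℕ → ℕ) (b e h : ℝ) : Prop where
  nonneg : 0 ≤ b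
  lt_one : b < 1
  pos : 0 < e
  lt_one' : e < 1
  mul_eq : h * b = 0
  sum_eq_one : e + h + b = 1
  tendsto : ∀ x y, Tendsto (fun i => ⟪y, (U ^ k i) (x - (b : ℂ) • U x)⟫_ℂ) atTop
    (𝓝 ⟪y, (e : ℂ) • x + (h : ℂ) • U x⟫_ℂ)

end UnitaryCLM

/-! ### Reduction of the two hypotheses to one -/

section Koopman

variable {X : Type*} [MeasurableSpace X] {μ : Measure X}

theorem koopmanCLM_eq (T : X ≃ᵐ X) (hT : MeasurePreserving T μ μ) :
    koopmanCLM T hT = unitaryCLM (koopman T hT) := rfl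

theorem exists_hasWeakLimit {T : X ≃ᵐ X} {hT : MeasurePreserving T μ μ} {a : ℝ}
    (ha : a ∈ Set.Ioo (0 : ℝ) 1) {k : ℕ → ℕ}
    (hlim :
      WeaklyConverges (fun i => koopmanCLM T hT ^ k i)
          ((a : ℂ) • (1 : Lp ℂ 2 μ →L[ℂ] Lp ℂ 2 μ) + ((1 - a : ℝ) : ℂ) • koopmanCLM T hT) ∨
      WeaklyConverges (fun i => koopmanCLM T hT ^ k i)
          (((1 - a : ℝ) : ℂ) • ∑' n : ℕ, (a : ℂ) ^ n • koopmanCLM T hT ^ n)) :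
    ∃ b e h, HasWeakLimit (koopman T hT) k b e h := by
  obtain ⟨ha0, ha1⟩ := ha
  rw [koopmanCLM_eq] at hlim
  rcases hlim with hlim | hlim
  · refine ⟨0, a, 1 - a, le_rfl, zero_lt_one, ha0, ha1, by ring, by ring, fun x y => ?_⟩
    have := hlim x y
    simp only [unitaryCLM_pow] at this
    simpa [-Complex.coe_smul, inner_add_right, inner_smul_right] using this
  · refine ⟨a, 1 - a, 0, ha0.le, ha1, by linarith, by linarith, by ring, by ring,
      fun x y => ?_⟩
    have := hlim (x - (a : ℂ) • koopman T hT x) y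
    simp only [unitaryCLM_pow] at this
    have hn : ‖(a : ℂ) • unitaryCLM (koopman T hT)‖ < 1 := by
      rw [norm_smul]
      refine (mul_le_of_le_one_right (norm_nonneg _) (norm_unitaryCLM_le _)).trans_lt ?_
      simpa [abs_of_pos ha0] using ha1
    -- The factor `1 - a U` cancels the geometric series, leaving the limit `(1 - a) x`.
    have hs := geom_series_mul_neg _ hn
    have hx : (∑' n : ℕ, (a : ℂ) ^ n • unitaryCLM (koopman T hT ^ n))
        (x - (a : ℂ) • koopman T hT x) = x := by
      have := congrArg (fun A : Lp ℂ 2 μ →L[ℂ] Lp ℂ 2 μ => A x) hs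
      simp only [smul_pow, unitaryCLM_pow] at this
      exact this
    rw [smul_apply, hx] at this
    simpa only [Complex.ofReal_zero, zero_smul, add_zero, unitaryCLM_apply] using this

end Koopman

/-! ### Weak limits of powers on the product; invariance under `T ⊗ 1 + 1 ⊗ T` -/

section Product

variable {X : Type*} [MeasurableSpace X] {μ : Measure X} [IsFiniteMeasure μ]

theorem inv_tensor {V : Lp ℂ 2 (μ.prod μ) ≃ₗᵢ[ℂ] Lp ℂ 2 (μ.prod μ)}
    {A B : Lp ℂ 2 μ ≃ₗᵢ[ℂ] Lp ℂ 2 μ} (h : ∀ f g, V (tensor f g) = tensor (A f) (B g))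
    (f g : Lp ℂ 2 μ) : V⁻¹ (tensor f g) = tensor (A⁻¹ f) (B⁻¹ g) := by
  apply V.injective
  rw [apply_inv_self, h, apply_inv_self, apply_inv_self]

theorem zpow_tensor {V : Lp ℂ 2 (μ.prod μ) ≃ₗᵢ[ℂ] Lp ℂ 2 (μ.prod μ)}
    {A B : Lp ℂ 2 μ ≃ₗᵢ[ℂ] Lp ℂ 2 μ} (h : ∀ f g, V (tensor f g) = tensor (A f) (B g))
    (n : ℤ) : ∀ f g, (V ^ n) (tensor f g) = tensor ((A ^ n) f) ((B ^ n) g) := by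
  induction n using Int.induction_on with
  | zero => exact fun f g => rfl
  | succ n ih =>
    intro f g
    simp only [zpow_succ_apply']
    rw [h, ih]
  | pred n ih =>
    intro f g
    rw [zpow_sub_one, zpow_sub_one, zpow_sub_one]
    change (V ^ (-(n : ℤ))) (V⁻¹ (tensor f g)) = _
    rw [inv_tensor h, ih]
    rfl

theorem ext_unitary_tensor {V W : Lp ℂ 2 (μ.prod μ) →L[ℂ] Lp ℂ 2 (μ.prod μ)}
    (h : ∀ f g, V (tensor f g) = W (tensor f g)) (u : Lp ℂ 2 (μ.prod μ)) : V u = W u :=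
  congrArg (fun A : Lp ℂ 2 (μ.prod μ) →L[ℂ] Lp ℂ 2 (μ.prod μ) => A u) (ext_tensor h)

variable (T : X ≃ᵐ X) (hT : MeasurePreserving T μ μ)

/-- The operator `T ⊗ T`. -/
def squareOp : Lp ℂ 2 (μ.prod μ) ≃ₗᵢ[ℂ] Lp ℂ 2 (μ.prod μ) :=
  koopman (square T) (measurePreserving_square T hT)

/-- The operator of the transformation `(x, y) ↦ (y, T x)`. -/
def twistOp : Lp ℂ 2 (μ.prod μ) ≃ₗᵢ[ℂ] Lp ℂ 2 (μ.prod μ) :=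
  koopman (twist T) (measurePreserving_twist T hT)

theorem squareOp_tensor (f g : Lp ℂ 2 μ) :
    squareOp T hT (tensor f g) = tensor (koopman T hT f) (koopman T hT g) :=
  koopman_square_tensor T hT f g

theorem twistOp_tensor (f g : Lp ℂ 2 μ) :
    twistOp T hT (tensor f g) = tensor (koopman T hT g) f :=
  koopman_twist_tensor T hT f g

theorem leftOp_rightOp (u : Lp ℂ 2 (μ.prod μ)) :
    leftOp T hT (rightOp T hT u) = squareOp T hT u :=
  ext_unitary_tensor (V := unitaryCLM (leftOp T hT) ∘L unitaryCLM (rightOp T hT))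
    (W := unitaryCLM (squareOp T hT))
    (fun f g => by simp [leftOp_tensor, rightOp_tensor, squareOp_tensor]) u

theorem rightOp_leftOp (u : Lp ℂ 2 (μ.prod μ)) :
    rightOp T hT (leftOp T hT u) = squareOp T hT u :=
  ext_unitary_tensor (V := unitaryCLM (rightOp T hT) ∘L unitaryCLM (leftOp T hT))
    (W := unitaryCLM (squareOp T hT))
    (fun f g => by simp [leftOp_tensor, rightOp_tensor, squareOp_tensor]) u

theorem twistOp_twistOp (u : Lp ℂ 2 (μ.prod μ)) :
    twistOp T hT (twistOp T hT u) = squareOp T hT u :=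
  ext_unitary_tensor (V := unitaryCLM (twistOp T hT) ∘L unitaryCLM (twistOp T hT))
    (W := unitaryCLM (squareOp T hT))
    (fun f g => by simp [twistOp_tensor, squareOp_tensor]) u

theorem swapOp_leftOp (u : Lp ℂ 2 (μ.prod μ)) :
    swapOp μ (leftOp T hT u) = rightOp T hT (swapOp μ u) :=
  ext_unitary_tensor (V := unitaryCLM (swapOp μ) ∘L unitaryCLM (leftOp T hT))
    (W := unitaryCLM (rightOp T hT) ∘L unitaryCLM (swapOp μ))
    (fun f g => by simp [leftOp_tensor, rightOp_tensor, swapOp_tensor]) u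

theorem swapOp_swapOp (u : Lp ℂ 2 (μ.prod μ)) : swapOp μ (swapOp μ u) = u :=
  ext_unitary_tensor (V := unitaryCLM (swapOp μ) ∘L unitaryCLM (swapOp μ))
    (W := ContinuousLinearMap.id ℂ _)
    (fun f g => by simp [swapOp_tensor]) u

theorem swapOp_rightOp (u : Lp ℂ 2 (μ.prod μ)) :
    swapOp μ (rightOp T hT u) = leftOp T hT (swapOp μ u) := by
  rw [← swapOp_swapOp (leftOp T hT (swapOp μ u)), swapOp_leftOp, swapOp_swapOp]

theorem swapOp_squareOp (u : Lp ℂ 2 (μ.prod μ)) :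
    swapOp μ (squareOp T hT u) = squareOp T hT (swapOp μ u) := by
  rw [← leftOp_rightOp, ← leftOp_rightOp, swapOp_leftOp, swapOp_rightOp, rightOp_leftOp,
    leftOp_rightOp]

theorem inner_swapOp_left (u v : Lp ℂ 2 (μ.prod μ)) :
    ⟪swapOp μ u, v⟫_ℂ = ⟪u, swapOp μ v⟫_ℂ := by
  rw [← (swapOp μ).inner_map_map, swapOp_swapOp]

variable {T hT} {k : ℕ → ℕ} {b e h : ℝ}

/-- The weak limit of the powers of `A ⊗ B`. -/
theorem HasWeakLimit.tendsto_tensor {A B : Lp ℂ 2 μ ≃ₗᵢ[ℂ] Lp ℂ 2 μ}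
    {V L R : Lp ℂ 2 (μ.prod μ) ≃ₗᵢ[ℂ] Lp ℂ 2 (μ.prod μ)}
    (hA : HasWeakLimit A k b e h) (hB : HasWeakLimit B k b e h)
    (hV : ∀ f g, V (tensor f g) = tensor (A f) (B g))
    (hL : ∀ f g, L (tensor f g) = tensor (A f) g) (hR : ∀ f g, R (tensor f g) = tensor f (B g))
    (x y : Lp ℂ 2 (μ.prod μ)) :
    Tendsto (fun i => ⟪y, (V ^ k i)
      ((1 - (b : ℂ) • unitaryCLM L) ((1 - (b : ℂ) • unitaryCLM R) x))⟫_ℂ)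
      atTop (𝓝 ⟪y, (e : ℂ) ^ 2 • x + ((e : ℂ) * h) • (L x + R x) + (h : ℂ) ^ 2 • V x⟫_ℂ) := by
  -- The operator `(1 - b L) (1 - b R)` is the tensor product of `1 - b A` and `1 - b B`, so the
  -- limit is `(e + h A) ⊗ (e + h B)`.
  let D₂ := (1 - (b : ℂ) • unitaryCLM L) ∘L (1 - (b : ℂ) • unitaryCLM R)
  let D (U : Lp ℂ 2 μ ≃ₗᵢ[ℂ] Lp ℂ 2 μ) := 1 - (b : ℂ) • unitaryCLM U
  let N (U : Lp ℂ 2 μ ≃ₗᵢ[ℂ] Lp ℂ 2 μ) :=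
    (e : ℂ) • (1 : Lp ℂ 2 μ →L[ℂ] Lp ℂ 2 μ) + (h : ℂ) • unitaryCLM U
  have hD : ∀ f g, D₂ (tensor f g) = tensor (D A f) (D B g) := by
    intro f g
    simp [-Complex.coe_smul, D, D₂, hL, hR]
    module
  refine tendsto_inner_tensor_apply (A := fun i => unitaryCLM (A ^ k i) ∘L D A)
    (B := fun i => unitaryCLM (B ^ k i) ∘L D B) (A₀ := N A) (B₀ := N B)
    (M := fun i => unitaryCLM (V ^ k i) ∘L D₂)
    (M₀ := (e : ℂ) ^ 2 • 1 + ((e : ℂ) * h) • (unitaryCLM L + unitaryCLM R) +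
      (h : ℂ) ^ 2 • unitaryCLM V)
    (c := ‖D₂‖) (fun i => ?_) (fun i f g => ?_) (fun f g => ?_) hA.tendsto hB.tendsto x y
  · refine (ContinuousLinearMap.opNorm_comp_le _ _).trans ?_
    exact mul_le_of_le_one_left (norm_nonneg _) (norm_unitaryCLM_le _)
  · have := zpow_tensor hV (k i) (D A f) (D B g)
    simp only [zpow_natCast] at this
    simp [hD, this]
  · simp only [N, add_apply, smul_apply, unitaryCLM_apply, hL, hR, hV, map_add, map_smul,
      one_apply_eq_self]
    module

theorem HasWeakLimit.tendsto_squareOp (H : HasWeakLimit (koopman T hT) k b e h)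
    (x y : Lp ℂ 2 (μ.prod μ)) :
    Tendsto (fun i => ⟪y, (squareOp T hT ^ k i)
      ((1 - (b : ℂ) • unitaryCLM (leftOp T hT)) ((1 - (b : ℂ) • unitaryCLM (rightOp T hT)) x))⟫_ℂ)
      atTop (𝓝 ⟪y, (e : ℂ) ^ 2 • x + ((e : ℂ) * h) • (leftOp T hT x + rightOp T hT x) +
        (h : ℂ) ^ 2 • squareOp T hT x⟫_ℂ) :=
  H.tendsto_tensor H (squareOp_tensor T hT) (leftOp_tensor T hT) (rightOp_tensor T hT) x y

/-- A closed subspace which reduces `T ⊗ T` is invariant under `T ⊗ 1 + 1 ⊗ T`. -/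
theorem HasWeakLimit.leftOp_add_rightOp_mem (H : HasWeakLimit (koopman T hT) k b e h)
    {C : Submodule ℂ (Lp ℂ 2 (μ.prod μ))} (hC : IsClosed (C : Set (Lp ℂ 2 (μ.prod μ))))
    (h₁ : ∀ x ∈ C, squareOp T hT x ∈ C) (h₂ : ∀ x ∈ C, (squareOp T hT)⁻¹ x ∈ C)
    {x : Lp ℂ 2 (μ.prod μ)} (hx : x ∈ C) : leftOp T hT x + rightOp T hT x ∈ C := by
  have hpow : ∀ i, ∀ x ∈ C, (squareOp T hT ^ k i) x ∈ C := fun i x hx => by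
    have := zpow_mem h₁ h₂ (k i) x hx
    rwa [zpow_natCast] at this
  have he : (e : ℂ) ≠ 0 := by exact_mod_cast H.pos.ne'
  rcases mul_eq_zero.1 H.mul_eq with h0 | b0
  -- Here `b = 1 - e` is positive, and the powers applied after `(1 - b L) (1 - b R)` tend to `e ^
  -- 2`. As this product is surjective, it preserves `C`; its expansion isolates `b (L + R)`.
  · subst h0
    have hb : (b : ℂ) ≠ 0 := by
      have := H.sum_eq_one
      have := H.lt_one'
      exact_mod_cast (show b ≠ 0 by intro hb; linarith)
    have hb1 : ‖(b : ℂ)‖ < 1 := by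
      simpa [abs_of_nonneg H.nonneg] using H.lt_one
    have hpow' : ∀ i, ∀ x ∈ Cᗮ, unitaryCLM (squareOp T hT ^ k i) x ∈ Cᗮ := fun i => by
      have h3 : ∀ x ∈ Cᗮ, squareOp T hT x ∈ Cᗮ := by
        intro x hx
        rw [Submodule.mem_orthogonal] at hx ⊢
        intro u hu
        rw [← inner_inv_left]
        exact hx _ (h₂ u hu)
      have h4 : ∀ x ∈ Cᗮ, (squareOp T hT)⁻¹ x ∈ Cᗮ := by
        intro x hx
        rw [Submodule.mem_orthogonal] at hx ⊢
        intro u hu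
        rw [← (squareOp T hT).inner_map_map, apply_inv_self]
        exact hx _ (h₁ u hu)
      intro x hx
      have := zpow_mem h3 h4 (k i) x hx
      rwa [zpow_natCast] at this
    have hsurj : Function.Surjective ((1 - (b : ℂ) • unitaryCLM (leftOp T hT)) ∘L
        (1 - (b : ℂ) • unitaryCLM (rightOp T hT))) := fun z => by
      obtain ⟨y, rfl⟩ := surjective_one_sub_smul (leftOp T hT) hb1 z
      obtain ⟨x, rfl⟩ := surjective_one_sub_smul (rightOp T hT) hb1 y
      exact ⟨x, rfl⟩
    have key := apply_mem_of_tendsto_smul hC (S := fun i => unitaryCLM (squareOp T hT ^ k i))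
      hpow hpow' hsurj
      (c := (e : ℂ) ^ 2) (pow_ne_zero 2 he) (fun x y => by
        have := H.tendsto_squareOp x y
        simp only [Complex.ofReal_zero, mul_zero, zero_smul, ne_eq, OfNat.ofNat_ne_zero,
          not_false_eq_true, zero_pow, add_zero] at this
        exact this) hx
    have hform : ((1 - (b : ℂ) • unitaryCLM (leftOp T hT)) ∘L
        (1 - (b : ℂ) • unitaryCLM (rightOp T hT))) x =
        x - (b : ℂ) • (leftOp T hT x + rightOp T hT x) + (b : ℂ) ^ 2 • squareOp T hT x := by
      simp only [ContinuousLinearMap.comp_apply, sub_apply,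
        one_apply_eq_self, smul_apply, unitaryCLM_apply,
        map_sub, map_smul, leftOp_rightOp]
      module
    rw [hform] at key
    have h5 : (b : ℂ) • (leftOp T hT x + rightOp T hT x) ∈ C := by
      have h6 := C.sub_mem (C.add_mem hx (C.smul_mem ((b : ℂ) ^ 2) (h₁ x hx))) key
      convert h6 using 1
      module
    exact (Submodule.smul_mem_iff _ hb).1 h5
  -- Here `h = 1 - e` is positive, and the weak limit of the powers at `x` stays in `C`. Removing
  -- its terms in `x` and `(T ⊗ T) x` leaves `e h (L + R) x`.
  · subst b0
    have hh : (h : ℂ) ≠ 0 := by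
      have := H.sum_eq_one
      have := H.lt_one'
      exact_mod_cast (show h ≠ 0 by intro hh; linarith)
    have key := mem_of_tendsto_inner hC (fun i => hpow i x hx) (v := (e : ℂ) ^ 2 • x +
      ((e : ℂ) * h) • (leftOp T hT x + rightOp T hT x) + (h : ℂ) ^ 2 • squareOp T hT x)
      (fun y => by
        have := H.tendsto_squareOp x y
        simp only [Complex.ofReal_zero, zero_smul, sub_zero, one_apply_eq_self] at this
        exact this)
    have h5 : ((e : ℂ) * h) • (leftOp T hT x + rightOp T hT x) ∈ C := by
      have h6 := C.sub_mem (C.sub_mem key (C.smul_mem ((e : ℂ) ^ 2) hx))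
        (C.smul_mem ((h : ℂ) ^ 2) (h₁ x hx))
      convert h6 using 1
      module
    exact (Submodule.smul_mem_iff _ (mul_ne_zero he hh)).1 h5

end Product

end

end SpectralErgodic

namespace SpectralErgodic

noncomputable section

/-! ### Inverses and fixed vectors of unitary operators -/

section Inverse

variable {E : Type*} [NormedAddCommGroup E] [InnerProductSpace ℂ E]

/-- Pass to adjoints: they preserve weak operator convergence, and the coefficients are real. -/
theorem HasWeakLimit.inv {U : E ≃ₗᵢ[ℂ] E} {k : ℕ → ℕ} {b e h : ℝ}
    (H : HasWeakLimit U k b e h) : HasWeakLimit U⁻¹ k b e h where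
  nonneg := H.nonneg
  lt_one := H.lt_one
  pos := H.pos
  lt_one' := H.lt_one'
  mul_eq := H.mul_eq
  sum_eq_one := H.sum_eq_one
  tendsto x y := by
    have h1 := tendsto_inner_swap.2 (H.tendsto y x)
    have h2 : ⟪(e : ℂ) • y + (h : ℂ) • U y, x⟫_ℂ = ⟪y, (e : ℂ) • x + (h : ℂ) • U⁻¹ x⟫_ℂ := by
      simp only [inner_add_left, inner_add_right, inner_smul_left, inner_smul_right,
        Complex.conj_ofReal]
      rw [← U.inner_map_map y (U⁻¹ x), apply_inv_self]
    rw [h2] at h1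
    refine h1.congr fun i => ?_
    rw [inv_pow, ← (U ^ k i).inner_map_map y, apply_inv_self]
    simp only [map_sub, map_smul, inner_sub_left, inner_sub_right, inner_smul_left,
      inner_smul_right, Complex.conj_ofReal]
    congr 2
    rw [← U.inner_map_map _ (U⁻¹ x), apply_inv_self]
    have : (U ^ k i) (U y) = U ((U ^ k i) y) := by
      have h3 : U ^ k i * U = U * U ^ k i := by rw [← pow_succ, ← pow_succ']
      exact congrArg (fun V : E ≃ₗᵢ[ℂ] E => V y) h3
    rw [this]

theorem zpow_apply_of_apply_eq {U : E ≃ₗᵢ[ℂ] E} {x : E} (hx : U x = x) (n : ℤ) :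
    (U ^ n) x = x := by
  induction n using Int.induction_on with
  | zero => rfl
  | succ n ih => rw [zpow_succ_apply', hx, ih]
  | pred n ih =>
    have h : U⁻¹ x = x := by conv_lhs => rw [← hx, inv_apply_self]
    rw [zpow_sub_one]
    exact (congrArg _ h).trans ih

/-- A unitary operator has no nontrivial Jordan block at the eigenvalue one. -/
theorem apply_eq_of_add_inv_eq {U : E ≃ₗᵢ[ℂ] E} {u : E} (h : U u + U⁻¹ u = (2 : ℂ) • u) :
    U u = u := by
  have h1 : U (U u - u) = U u - u := by
    have h2 : U (U u) + u = (2 : ℂ) • U u := by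
      rw [← map_smul, ← h, map_add, apply_inv_self]
    rw [map_sub, eq_sub_of_add_eq h2]
    module
  -- The fixed vector `U u - u` is orthogonal to the range of `U - 1`, in which it lies.
  have h3 : ⟪U u - u, U u⟫_ℂ = ⟪U u - u, u⟫_ℂ := by
    conv_lhs => rw [← h1]
    exact U.inner_map_map _ _
  have h4 : ⟪U u - u, U u - u⟫_ℂ = 0 := by rw [inner_sub_right, h3, sub_self]
  exact sub_eq_zero.1 (inner_self_eq_zero.1 h4)

end Inverse

/-! ### Ergodicity and the injectivity of `T ⊗ 1 - 1 ⊗ T` -/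

section MeanZero

variable {X : Type*} [MeasurableSpace X] {μ : Measure X} [IsProbabilityMeasure μ]
  {T : X ≃ᵐ X}

theorem mem_meanZero {f : Lp ℂ 2 μ} : f ∈ meanZero μ ↔ ⟪Lp.const 2 μ (1 : ℂ), f⟫_ℂ = 0 :=
  Submodule.mem_orthogonal_singleton_iff_inner_right

theorem isClosed_meanZero : IsClosed (meanZero μ : Set (Lp ℂ 2 μ)) :=
  Submodule.isClosed_orthogonal _

theorem inner_const_koopman {hT : MeasurePreserving T μ μ} (f : Lp ℂ 2 μ) :
    ⟪Lp.const 2 μ (1 : ℂ), koopman T hT f⟫_ℂ = ⟪Lp.const 2 μ (1 : ℂ), f⟫_ℂ := by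
  conv_lhs => rw [← koopman_one T hT]
  exact (koopman T hT).inner_map_map _ _

theorem koopman_mem_meanZero {hT : MeasurePreserving T μ μ} {f : Lp ℂ 2 μ}
    (hf : f ∈ meanZero μ) : koopman T hT f ∈ meanZero μ := by
  rwa [mem_meanZero, inner_const_koopman, ← mem_meanZero]

theorem koopman_inv_mem_meanZero {hT : MeasurePreserving T μ μ} {f : Lp ℂ 2 μ}
    (hf : f ∈ meanZero μ) : (koopman T hT)⁻¹ f ∈ meanZero μ := by
  rwa [mem_meanZero, ← inner_const_koopman (hT := hT), apply_inv_self, ← mem_meanZero]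

/-- Invariant functions of an ergodic transformation are constant. -/
theorem mem_span_const_of_koopman_eq (hT : Ergodic T μ) {f : Lp ℂ 2 μ}
    (hf : koopman T hT.toMeasurePreserving f = f) :
    f ∈ Submodule.span ℂ {Lp.const 2 μ (1 : ℂ)} := by
  have h1 : f ∘ T =ᵐ[μ] f := by
    refine (coeFn_koopman T hT.toMeasurePreserving f).symm.trans ?_
    rw [hf]
  obtain ⟨c, hc⟩ := hT.ae_eq_const_of_ae_eq_comp_ae (Lp.aestronglyMeasurable f) h1
  rw [Submodule.mem_span_singleton]
  refine ⟨c, Lp.ext ?_⟩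
  refine (Lp.coeFn_smul _ _).trans (EventuallyEq.trans ?_ hc.symm)
  refine Eventually.of_forall fun x => ?_
  simp

theorem eq_zero_of_koopman_eq (hT : Ergodic T μ) {f : Lp ℂ 2 μ}
    (hf : koopman T hT.toMeasurePreserving f = f) (hf' : f ∈ meanZero μ) : f = 0 := by
  have h1 := mem_span_const_of_koopman_eq hT hf
  exact inner_self_eq_zero.1 (Submodule.inner_right_of_mem_orthogonal h1 hf')

theorem exists_meanZero_add_const (f : Lp ℂ 2 μ) :
    ∃ f₀ ∈ meanZero μ, ∃ c : ℂ, f = f₀ + c • Lp.const 2 μ (1 : ℂ) := by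
  obtain ⟨y, hy, z, hz, h⟩ := Submodule.exists_add_mem_mem_orthogonal
    (K := Submodule.span ℂ {Lp.const 2 μ (1 : ℂ)}) f
  obtain ⟨c, rfl⟩ := Submodule.mem_span_singleton.1 hy
  exact ⟨z, hz, c, by rw [h, add_comm]⟩

theorem tensor_const_const :
    tensor (Lp.const 2 μ (1 : ℂ)) (Lp.const 2 μ (1 : ℂ)) = Lp.const 2 (μ.prod μ) (1 : ℂ) := by
  refine tensor_ext (Lp.coeFn_const 2 μ (1 : ℂ)) (Lp.coeFn_const 2 μ (1 : ℂ)) ?_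
  refine (Lp.coeFn_const 2 (μ.prod μ) (1 : ℂ)).trans (Eventually.of_forall fun p => ?_)
  simp

theorem tensor_mem_meanZero_left {f : Lp ℂ 2 μ} (hf : f ∈ meanZero μ) (g : Lp ℂ 2 μ) :
    tensor f g ∈ meanZero (μ.prod μ) := by
  rw [mem_meanZero, ← tensor_const_const, inner_tensor, mem_meanZero.1 hf, zero_mul]

theorem tensor_mem_meanZero_right {g : Lp ℂ 2 μ} (hg : g ∈ meanZero μ) (f : Lp ℂ 2 μ) :
    tensor f g ∈ meanZero (μ.prod μ) := by
  rw [mem_meanZero, ← tensor_const_const, inner_tensor, mem_meanZero.1 hg, mul_zero]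

/-- A vector of `L²(X × X)` is zero if it is orthogonal to the four types of tensor products. -/
theorem eq_zero_of_inner_tensor_meanZero {u : Lp ℂ 2 (μ.prod μ)}
    (h₀ : u ∈ meanZero (μ.prod μ))
    (h₁ : ∀ f ∈ meanZero μ, ⟪tensor f (Lp.const 2 μ (1 : ℂ)), u⟫_ℂ = 0)
    (h₂ : ∀ f ∈ meanZero μ, ⟪tensor (Lp.const 2 μ (1 : ℂ)) f, u⟫_ℂ = 0)
    (h₃ : ∀ f ∈ meanZero μ, ∀ g ∈ meanZero μ, ⟪tensor f g, u⟫_ℂ = 0) : u = 0 := by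
  refine eq_zero_of_inner_tensor_eq_zero fun f g => ?_
  obtain ⟨f₀, hf, c, rfl⟩ := exists_meanZero_add_const f
  obtain ⟨g₀, hg, d, rfl⟩ := exists_meanZero_add_const g
  have h4 := mem_meanZero.1 h₀
  rw [← tensor_const_const] at h4
  simp [inner_add_left, inner_smul_left, h₁ f₀ hf, h₂ g₀ hg, h₃ f₀ hf g₀ hg, h4]

/-- For fixed `g`, the functional `f ↦ ⟪f ⊗ g, u⟫` is represented by a `T`-invariant vector. By
ergodicity this vector is constant, hence orthogonal to `f`. -/
theorem inner_tensor_eq_zero_of_leftOp_eq (hT : Ergodic T μ) {u : Lp ℂ 2 (μ.prod μ)}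
    (hu : leftOp T hT.toMeasurePreserving u = u) {f : Lp ℂ 2 μ} (hf : f ∈ meanZero μ)
    (g : Lp ℂ 2 μ) : ⟪tensor f g, u⟫_ℂ = 0 := by
  let A : Lp ℂ 2 μ →L[ℂ] Lp ℂ 2 (μ.prod μ) := tensor.flip g
  have hA : ∀ f, ⟪f, ContinuousLinearMap.adjoint A u⟫_ℂ = ⟪tensor f g, u⟫_ℂ := fun f =>
    ContinuousLinearMap.adjoint_inner_right A f u
  have hinv : koopman T hT.toMeasurePreserving (ContinuousLinearMap.adjoint A u) =
      ContinuousLinearMap.adjoint A u := by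
    refine ext_inner_left ℂ fun f => ?_
    rw [← inner_inv_left, hA, hA, ← (leftOp T hT.toMeasurePreserving).inner_map_map,
      leftOp_tensor, apply_inv_self, hu]
  rw [← hA]
  exact Submodule.inner_left_of_mem_orthogonal (mem_span_const_of_koopman_eq hT hinv) hf

theorem inner_tensor_eq_zero_of_rightOp_eq (hT : Ergodic T μ) {u : Lp ℂ 2 (μ.prod μ)}
    (hu : rightOp T hT.toMeasurePreserving u = u) {g : Lp ℂ 2 μ} (hg : g ∈ meanZero μ)
    (f : Lp ℂ 2 μ) : ⟪tensor f g, u⟫_ℂ = 0 := by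
  have h1 : leftOp T hT.toMeasurePreserving (swapOp μ u) = swapOp μ u := by
    rw [← swapOp_rightOp, hu]
  have := inner_tensor_eq_zero_of_leftOp_eq hT h1 hg f
  rwa [← inner_swapOp_left, swapOp_tensor] at this

theorem eq_zero_of_leftOp_eq_of_rightOp_eq (hT : Ergodic T μ) {u : Lp ℂ 2 (μ.prod μ)}
    (h₀ : u ∈ meanZero (μ.prod μ)) (h₁ : leftOp T hT.toMeasurePreserving u = u)
    (h₂ : rightOp T hT.toMeasurePreserving u = u) : u = 0 :=
  eq_zero_of_inner_tensor_meanZero h₀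
    (fun _ hf => inner_tensor_eq_zero_of_leftOp_eq hT h₁ hf _)
    (fun _ hf => inner_tensor_eq_zero_of_rightOp_eq hT h₂ hf _)
    (fun _ hf _ _ => inner_tensor_eq_zero_of_leftOp_eq hT h₁ hf _)

variable {k : ℕ → ℕ} {b e h : ℝ}

/-- The operator `T ⊗ 1 - 1 ⊗ T` is injective on the functions with zero mean. -/
theorem HasWeakLimit.eq_zero_of_leftOp_eq_rightOp (hT : Ergodic T μ)
    (H : HasWeakLimit (koopman T hT.toMeasurePreserving) k b e h) {u : Lp ℂ 2 (μ.prod μ)}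
    (h₀ : u ∈ meanZero (μ.prod μ))
    (hu : leftOp T hT.toMeasurePreserving u = rightOp T hT.toMeasurePreserving u) : u = 0 := by
  let L := leftOp T hT.toMeasurePreserving
  let R := rightOp T hT.toMeasurePreserving
  have hLR : ∀ u, L (R u) = R (L u) := fun u => by
    rw [leftOp_rightOp, rightOp_leftOp]
  have hLRi : ∀ u, L (R⁻¹ u) = R⁻¹ (L u) := fun u => by
    rw [← inv_apply_self R (L (R⁻¹ u)), ← hLR, apply_inv_self]
  have hu' : L u = R u := hu
  have hLi : R⁻¹ u = L⁻¹ u := by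
    rw [← inv_apply_self L (R⁻¹ u), hLRi, hu', inv_apply_self]
  have hV : ∀ x, (L * R⁻¹) x = L (R⁻¹ x) := fun _ => rfl
  have hVu : (L * R⁻¹) u = u := by rw [hV, hLi, apply_inv_self]
  have hVL : ∀ x, (L * R⁻¹) x = x → (L * R⁻¹) (L x) = L x := fun x hx => by
    rw [hV, ← hLRi, ← hV, hx]
  have hVR : ∀ x, (L * R⁻¹) x = x → (L * R⁻¹) (R⁻¹ x) = R⁻¹ x := fun x hx => by
    rw [hV, hLRi, ← hV, hx]
  -- The operator `T ⊗ T⁻¹ = L * R⁻¹` fixes `u` and therefore `w`, so the sequence in the weak limit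
  -- for its powers is constant and `w` equals the limit.
  let w := (1 - (b : ℂ) • unitaryCLM L) ((1 - (b : ℂ) • unitaryCLM R⁻¹) u)
  have hw : w = u - (b : ℂ) • (L u + R⁻¹ u) + (b : ℂ) ^ 2 • u := by
    simp only [w, sub_apply, one_apply_eq_self, smul_apply, unitaryCLM_apply,
      map_sub, map_smul, ← hV, hVu]
    module
  have hVw : (L * R⁻¹) w = w := by
    rw [hw]
    simp only [map_add, map_sub, map_smul, hVL u hVu, hVR u hVu, hVu]
  have hlim : w = (e : ℂ) ^ 2 • u + ((e : ℂ) * h) • (L u + R⁻¹ u) + (h : ℂ) ^ 2 • u := by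
    refine ext_inner_left ℂ fun y => ?_
    have h1 := H.tendsto_tensor H.inv (V := L * R⁻¹) (L := L) (R := R⁻¹)
      (fun f g => by
        rw [hV, inv_tensor (A := 1) (rightOp_tensor T hT.toMeasurePreserving), leftOp_tensor]; rfl)
      (leftOp_tensor T hT.toMeasurePreserving)
      (fun f g => by
        rw [inv_tensor (A := 1) (rightOp_tensor T hT.toMeasurePreserving)]; rfl) u y
    rw [hVu] at h1
    refine tendsto_nhds_unique ?_ h1
    refine tendsto_const_nhds.congr fun i => ?_
    rw [← zpow_natCast, zpow_apply_of_apply_eq hVw]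
  have hne : ((b + e * h : ℝ) : ℂ) ≠ 0 := by
    have h1 := H.sum_eq_one
    have h2 := H.lt_one'
    have h3 := H.pos
    rcases mul_eq_zero.1 H.mul_eq with h0 | b0
    · exact_mod_cast (show b + e * h ≠ 0 by rw [h0, mul_zero]; intro; linarith)
    · have : 0 < e * h := mul_pos h3 (by linarith)
      exact_mod_cast (show b + e * h ≠ 0 by rw [b0]; intro; linarith)
  have hL : L u = u := by
    apply apply_eq_of_add_inv_eq
    rw [← hLi]
    -- Comparing both expressions for `w` gives `(b + e h) (L u + R⁻¹ u) = (1 + b² - e² - h²) u`,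
    -- and the coefficient on the right is twice the one on the left because `e + h + b = 1`.
    have hc : (1 + (b : ℂ) ^ 2 - (e : ℂ) ^ 2 - (h : ℂ) ^ 2) = 2 * ((b + e * h : ℝ) : ℂ) := by
      have h1 := H.sum_eq_one
      have : 1 + b ^ 2 - e ^ 2 - h ^ 2 = 2 * (b + e * h) := by
        have h3 : e = 1 - h - b := by linarith
        subst h3
        ring
      exact_mod_cast this
    have h4 : ((b + e * h : ℝ) : ℂ) • (L u + R⁻¹ u) = ((b + e * h : ℝ) : ℂ) • ((2 : ℂ) • u) := by
      rw [smul_smul, mul_comm _ (2 : ℂ), ← hc]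
      rw [hw] at hlim
      have h5 := sub_eq_zero.2 hlim
      rw [← sub_eq_zero]
      rw [← neg_eq_zero, ← h5]
      push_cast
      module
    exact smul_right_injective _ hne h4
  exact eq_zero_of_leftOp_eq_of_rightOp_eq hT h₀ hL (hu.symm.trans hL)

end MeanZero

end

end SpectralErgodic

namespace SpectralErgodic

noncomputable section

/-! ### Restrictions, and vectors with orbit orthogonal to a given one -/

section Restrict

variable {E : Type*} [NormedAddCommGroup E] [InnerProductSpace ℂ E]

theorem restrictUnitary_inv_apply (U : E ≃ₗᵢ[ℂ] E) (S : Submodule ℂ E)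
    (hS : S.map (U.toLinearEquiv : E →ₗ[ℂ] E) = S) (v : S) :
    (((restrictUnitary U S hS)⁻¹ v : S) : E) = U⁻¹ v := by
  apply U.injective
  rw [← restrictUnitary_apply U S hS, apply_inv_self, apply_inv_self]

theorem restrictUnitary_zpow_apply (U : E ≃ₗᵢ[ℂ] E) (S : Submodule ℂ E)
    (hS : S.map (U.toLinearEquiv : E →ₗ[ℂ] E) = S) (n : ℤ) :
    ∀ v : S, (((restrictUnitary U S hS ^ n) v : S) : E) = (U ^ n) v := by
  induction n using Int.induction_on with
  | zero => exact fun v => rfl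
  | succ n ih =>
    intro v
    rw [zpow_succ_apply', zpow_succ_apply', ih, restrictUnitary_apply]
  | pred n ih =>
    intro v
    rw [zpow_sub_one, zpow_sub_one]
    exact (ih _).trans (congrArg _ (restrictUnitary_inv_apply U S hS v))

theorem hasSimpleSpectrum_restrictUnitary_iff [CompleteSpace E] {U : E ≃ₗᵢ[ℂ] E}
    {S : Submodule ℂ E} (hS : S.map (U.toLinearEquiv : E →ₗ[ℂ] E) = S)
    (hc : IsClosed (S : Set E)) :
    HasSimpleSpectrum (restrictUnitary U S hS) ↔
      ∃ x ∈ S, ∀ y ∈ S, (∀ n : ℤ, ⟪(U ^ n) x, y⟫_ℂ = 0) → y = 0 := by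
  have : CompleteSpace S := hc.completeSpace_coe
  rw [hasSimpleSpectrum_iff]
  simp only [Submodule.coe_inner, restrictUnitary_zpow_apply, Subtype.exists, Subtype.forall,
    Submodule.mk_eq_zero, exists_prop]

/-- The set of vectors whose `U`-orbit is orthogonal to `y`. -/
def orbitOrthogonal (U : E ≃ₗᵢ[ℂ] E) (y : E) : Submodule ℂ E where
  carrier := {x | ∀ n : ℤ, ⟪(U ^ n) x, y⟫_ℂ = 0}
  zero_mem' n := by simp
  add_mem' hx hx' n := by simp [hx n, hx' n]
  smul_mem' c x hx n := by simp [hx n]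

theorem mem_orbitOrthogonal {U : E ≃ₗᵢ[ℂ] E} {x y : E} :
    x ∈ orbitOrthogonal U y ↔ ∀ n : ℤ, ⟪(U ^ n) x, y⟫_ℂ = 0 := Iff.rfl

theorem isClosed_orbitOrthogonal (U : E ≃ₗᵢ[ℂ] E) (y : E) :
    IsClosed (orbitOrthogonal U y : Set E) := by
  have : (orbitOrthogonal U y : Set E) = ⋂ n : ℤ, {x | ⟪(U ^ n) x, y⟫_ℂ = 0} := by
    ext x
    simp [mem_orbitOrthogonal]
  rw [this]
  refine isClosed_iInter fun n => isClosed_eq ?_ continuous_const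
  exact (U ^ n).continuous.inner continuous_const

theorem apply_mem_orbitOrthogonal {U : E ≃ₗᵢ[ℂ] E} {x y : E} (hx : x ∈ orbitOrthogonal U y) :
    U x ∈ orbitOrthogonal U y := fun n => by
  rw [← zpow_succ_apply']
  exact hx (n + 1)

theorem inv_apply_mem_orbitOrthogonal {U : E ≃ₗᵢ[ℂ] E} {x y : E}
    (hx : x ∈ orbitOrthogonal U y) : U⁻¹ x ∈ orbitOrthogonal U y := fun n => by
  have := hx (n - 1)
  rwa [zpow_sub_one] at this

theorem inner_eq_zero_of_mem_orbitOrthogonal {U : E ≃ₗᵢ[ℂ] E} {x y : E}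
    (hx : x ∈ orbitOrthogonal U y) : ⟪x, y⟫_ℂ = 0 := hx 0

end Restrict

/-! ### Cyclic vectors on the product -/

section Cyclic

variable {X : Type*} [MeasurableSpace X] {μ : Measure X} [IsProbabilityMeasure μ]
  {T : X ≃ᵐ X}

/-- `f` is a cyclic vector of `U` in the space of functions with zero mean. -/
structure IsCyclicMeanZero (U : Lp ℂ 2 μ ≃ₗᵢ[ℂ] Lp ℂ 2 μ) (f : Lp ℂ 2 μ) : Prop where
  mem : f ∈ meanZero μ
  eq_zero : ∀ y ∈ meanZero μ, (∀ n : ℤ, ⟪(U ^ n) f, y⟫_ℂ = 0) → y = 0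

theorem exists_isCyclicMeanZero {hT : MeasurePreserving T μ μ}
    (h : HasSimpleSpectrum (koopmanZero T hT)) : ∃ f, IsCyclicMeanZero (koopman T hT) f := by
  obtain ⟨f, hf, h⟩ := (hasSimpleSpectrum_restrictUnitary_iff (map_meanZero T hT)
    isClosed_meanZero).1 h
  exact ⟨f, hf, h⟩

/-- The component of a mean-zero vector orthogonal to `C ⊓ meanZero μ` is orthogonal to the orbit of
`f`, so it vanishes. -/
theorem IsCyclicMeanZero.le {hT : MeasurePreserving T μ μ} {f : Lp ℂ 2 μ}
    (hf : IsCyclicMeanZero (koopman T hT) f) {C : Submodule ℂ (Lp ℂ 2 μ)}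
    (hC : IsClosed (C : Set (Lp ℂ 2 μ))) (h : ∀ n : ℤ, (koopman T hT ^ n) f ∈ C) :
    meanZero μ ≤ C := by
  let D := C ⊓ meanZero μ
  have hD : IsClosed (D : Set (Lp ℂ 2 μ)) := hC.inter isClosed_meanZero
  have : CompleteSpace D := hD.completeSpace_coe
  intro x hx
  obtain ⟨y, hy, z, hz, rfl⟩ := Submodule.exists_add_mem_mem_orthogonal (K := D) x
  have hz0 : z = 0 := by
    refine hf.eq_zero z ?_ fun n => ?_
    · simpa using (meanZero μ).sub_mem hx hy.2
    · refine Submodule.inner_right_of_mem_orthogonal (K := D) ⟨h n, ?_⟩ hz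
      exact zpow_mem (fun _ => koopman_mem_meanZero) (fun _ => koopman_inv_mem_meanZero) n _
        hf.mem
  rw [hz0, add_zero]
  exact hy.1

/-- If `y` is orthogonal to the orbit of `U f - f`, then `U⁻¹ y - y` is orthogonal to the orbit of
`f`. Thus `y` is invariant, and ergodicity makes it zero. -/
theorem IsCyclicMeanZero.sub (hT : Ergodic T μ) {f : Lp ℂ 2 μ}
    (hf : IsCyclicMeanZero (koopman T hT.toMeasurePreserving) f) :
    IsCyclicMeanZero (koopman T hT.toMeasurePreserving)
      (koopman T hT.toMeasurePreserving f - f) where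
  mem := (meanZero μ).sub_mem (koopman_mem_meanZero hf.mem) hf.mem
  eq_zero y hy h := by
    let U := koopman T hT.toMeasurePreserving
    have h1 : U⁻¹ y - y = 0 := by
      refine hf.eq_zero _ ((meanZero μ).sub_mem (koopman_inv_mem_meanZero hy) hy) fun n => ?_
      have h2 := h n
      rw [map_sub, inner_sub_left, ← zpow_succ_apply', zpow_succ_apply] at h2
      rw [inner_sub_right, ← U.inner_map_map _ (U⁻¹ y), apply_inv_self]
      exact h2
    refine eq_zero_of_koopman_eq hT ?_ hy
    change U y = y
    nth_rewrite 1 [← sub_eq_zero.1 h1]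
    exact apply_inv_self U y

theorem IsCyclicMeanZero.linear_mem {hT : MeasurePreserving T μ μ} {f : Lp ℂ 2 μ}
    (hf : IsCyclicMeanZero (koopman T hT) f) {F : Type*} [NormedAddCommGroup F]
    [NormedSpace ℂ F] (B : Lp ℂ 2 μ →L[ℂ] F) {C : Submodule ℂ F}
    (hC : IsClosed (C : Set F)) (h : ∀ n : ℤ, B ((koopman T hT ^ n) f) ∈ C) {x : Lp ℂ 2 μ}
    (hx : x ∈ meanZero μ) : B x ∈ C :=
  hf.le (C := C.comap (B : Lp ℂ 2 μ →ₗ[ℂ] F)) (hC.preimage B.continuous) h hx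

/-- A continuous bilinear map which takes the pairs of vectors of the orbit of a cyclic vector to
a closed subspace takes there all pairs. -/
theorem IsCyclicMeanZero.bilinear_mem {hT : MeasurePreserving T μ μ} {f : Lp ℂ 2 μ}
    (hf : IsCyclicMeanZero (koopman T hT) f) {F : Type*} [NormedAddCommGroup F]
    [NormedSpace ℂ F] (B : Lp ℂ 2 μ →L[ℂ] Lp ℂ 2 μ →L[ℂ] F) {C : Submodule ℂ F}
    (hC : IsClosed (C : Set F))
    (h : ∀ m n : ℤ, B ((koopman T hT ^ m) f) ((koopman T hT ^ n) f) ∈ C) {x y : Lp ℂ 2 μ}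
    (hx : x ∈ meanZero μ) (hy : y ∈ meanZero μ) : B x y ∈ C := by
  have h1 : ∀ m : ℤ, B ((koopman T hT ^ m) f) y ∈ C := fun m =>
    hf.linear_mem (B ((koopman T hT ^ m) f)) hC (h m) hy
  exact hf.linear_mem (B.flip y) hC h1 hx

variable {k : ℕ → ℕ} {b e h : ℝ}

/-- With `s j` the symmetrization of `U ^ j g ⊗ g`, one has `s (j + 2) = (L + R) (s (j + 1)) - (T ⊗
T) (s j)`, and `T ⊗ T` shifts both exponents together. -/
theorem HasWeakLimit.symm_tensor_orbit_mem {hT : MeasurePreserving T μ μ}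
    (H : HasWeakLimit (koopman T hT) k b e h) {C : Submodule ℂ (Lp ℂ 2 (μ.prod μ))}
    (hC : IsClosed (C : Set (Lp ℂ 2 (μ.prod μ))))
    (h₁ : ∀ x ∈ C, squareOp T hT x ∈ C) (h₂ : ∀ x ∈ C, (squareOp T hT)⁻¹ x ∈ C)
    {g : Lp ℂ 2 μ} (hg : tensor g g ∈ C) (m n : ℤ) :
    tensor ((koopman T hT ^ m) g) ((koopman T hT ^ n) g) +
      tensor ((koopman T hT ^ n) g) ((koopman T hT ^ m) g) ∈ C := by
  let U := koopman T hT
  let s : ℕ → Lp ℂ 2 (μ.prod μ) := fun j => tensor ((U ^ j) g) g + tensor g ((U ^ j) g)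
  have hU : ∀ (j : ℕ) (x : Lp ℂ 2 μ), U ((U ^ j) x) = (U ^ (j + 1)) x := fun j x => by
    rw [pow_succ']
    rfl
  have hs : ∀ j, s j ∈ C ∧ s (j + 1) ∈ C := by
    intro j
    induction j with
    | zero =>
      refine ⟨C.add_mem hg hg, ?_⟩
      have := H.leftOp_add_rightOp_mem hC h₁ h₂ hg
      rw [leftOp_tensor, rightOp_tensor] at this
      simpa [s] using this
    | succ j ih =>
      refine ⟨ih.2, ?_⟩
      have h3 := C.sub_mem (H.leftOp_add_rightOp_mem hC h₁ h₂ ih.2) (h₁ _ ih.1)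
      convert h3 using 1
      have h4 : koopman T hT ((U ^ (j + 1)) g) = (U ^ (j + 1 + 1)) g := hU _ _
      have h5 : koopman T hT ((U ^ j) g) = (U ^ (j + 1)) g := hU _ _
      simp only [s, map_add, leftOp_tensor, rightOp_tensor, squareOp_tensor, h4, h5]
      abel
  have key : ∀ (n : ℤ) (j : ℕ), tensor ((U ^ (n + j)) g) ((U ^ n) g) +
      tensor ((U ^ n) g) ((U ^ (n + j)) g) ∈ C := by
    intro n j
    have h3 := zpow_mem h₁ h₂ n _ (hs j).1
    simp only [s, map_add, zpow_tensor (squareOp_tensor T hT)] at h3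
    have h4 : (U ^ n) ((U ^ j) g) = (U ^ (n + j)) g := by
      rw [zpow_add, zpow_natCast]
      rfl
    rwa [← h4]
  rcases le_total n m with hnm | hnm
  · obtain ⟨j, rfl⟩ := Int.le.dest hnm
    exact key n j
  · obtain ⟨j, rfl⟩ := Int.le.dest hnm
    rw [add_comm]
    exact key m j

/-- A closed subspace reducing `T ⊗ T` contains all symmetric tensors as soon as it contains a
vector whose image under `(T - 1) ⊗ (T - 1)` is `(T - 1) f ⊗ (T - 1) f`. -/
theorem HasWeakLimit.symm_tensor_mem {hT : MeasurePreserving T μ μ}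
    (H : HasWeakLimit (koopman T hT) k b e h)
    {C : Submodule ℂ (Lp ℂ 2 (μ.prod μ))} (hC : IsClosed (C : Set (Lp ℂ 2 (μ.prod μ))))
    (h₁ : ∀ x ∈ C, squareOp T hT x ∈ C)
    (h₂ : ∀ x ∈ C, (squareOp T hT)⁻¹ x ∈ C) {f : Lp ℂ 2 μ}
    (hf : IsCyclicMeanZero (koopman T hT) (koopman T hT f - f))
    {v : Lp ℂ 2 (μ.prod μ)} (hv : v ∈ C)
    (hvf : v - (leftOp T hT v + rightOp T hT v) +
      squareOp T hT v =
        tensor (koopman T hT f - f) (koopman T hT f - f))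
    {x y : Lp ℂ 2 μ} (hx : x ∈ meanZero μ) (hy : y ∈ meanZero μ) :
    tensor x y + tensor y x ∈ C := by
  have hg : tensor (koopman T hT f - f)
      (koopman T hT f - f) ∈ C := by
    rw [← hvf]
    exact C.add_mem (C.sub_mem hv (H.leftOp_add_rightOp_mem hC h₁ h₂ hv)) (h₁ _ hv)
  exact hf.bilinear_mem (tensor + tensor.flip) hC
    (fun m n => H.symm_tensor_orbit_mem hC h₁ h₂ hg m n) hx hy

/-- A closed subspace reducing the operator of `(x, y) ↦ (y, T x)` which contains the symmetric
tensors contains all tensors. -/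
theorem IsCyclicMeanZero.tensor_mem {hT : MeasurePreserving T μ μ} {f : Lp ℂ 2 μ}
    (hf : IsCyclicMeanZero (koopman T hT) f) {C : Submodule ℂ (Lp ℂ 2 (μ.prod μ))}
    (hC : IsClosed (C : Set (Lp ℂ 2 (μ.prod μ)))) (h₁ : ∀ x ∈ C, twistOp T hT x ∈ C)
    (hsymm : ∀ x ∈ meanZero μ, ∀ y ∈ meanZero μ, tensor x y + tensor y x ∈ C)
    {x y : Lp ℂ 2 μ} (hx : x ∈ meanZero μ) (hy : y ∈ meanZero μ) : tensor x y ∈ C := by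
  let φ : ℤ → ℤ → Lp ℂ 2 (μ.prod μ) := fun m n =>
    tensor ((koopman T hT ^ m) f) ((koopman T hT ^ n) f)
  have horb : ∀ n : ℤ, (koopman T hT ^ n) f ∈ meanZero μ := fun n =>
    zpow_mem (fun _ => koopman_mem_meanZero) (fun _ => koopman_inv_mem_meanZero) n _ hf.mem
  have hsum : ∀ m n, φ m n + φ n m ∈ C := fun m n => hsymm _ (horb m) _ (horb n)
  -- The operator takes `φ m n + φ n m` to `φ (n + 1) m + φ (m + 1) n`. Hence, modulo `C`, a unit of
  -- exponent may be moved from one factor to the other.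
  have hshift : ∀ m n, φ (m + 1) n - φ m (n + 1) ∈ C := by
    intro m n
    have h2 := h₁ _ (hsum m n)
    simp only [φ, map_add, twistOp_tensor, ← zpow_succ_apply] at h2
    have h3 := C.sub_mem h2 (hsum m (n + 1))
    convert h3 using 1
    simp only [φ]
    abel
  have hshift' : ∀ (j : ℕ) (m n : ℤ), φ (m + j) n - φ m (n + j) ∈ C := by
    intro j
    induction j with
    | zero => intro m n; simp
    | succ j ih =>
      intro m n
      have h2 := C.add_mem (hshift (m + j) n) (ih m (n + 1))
      convert h2 using 1
      push_cast
      rw [show m + (j + 1 : ℤ) = m + j + 1 by ring, show n + (j + 1 : ℤ) = n + 1 + j by ring]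
      abel
  -- Moving `j` units exchanges the two exponents, so the difference of `φ (n + j) n` and `φ n (n +
  -- j)` lies in `C` together with their sum.
  have key : ∀ (n : ℤ) (j : ℕ), φ (n + j) n ∈ C := by
    intro n j
    have h2 := C.add_mem (hshift' j n n) (hsum (n + j) n)
    have h3 : (2 : ℂ) • φ (n + j) n ∈ C := by
      convert h2 using 1
      module
    exact (Submodule.smul_mem_iff _ two_ne_zero).1 h3
  refine hf.bilinear_mem tensor hC (fun m n => ?_) hx hy
  change φ m n ∈ C
  rcases le_total n m with hnm | hnm
  · obtain ⟨j, rfl⟩ := Int.le.dest hnm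
    exact key n j
  · obtain ⟨j, rfl⟩ := Int.le.dest hnm
    have := C.sub_mem (hsum m (m + j)) (key m j)
    simpa using this

/-- The operator of `(x, y) ↦ (y, T x)` has simple spectrum. -/
theorem HasWeakLimit.hasSimpleSpectrum_twist (hT : Ergodic T μ)
    (H : HasWeakLimit (koopman T hT.toMeasurePreserving) k b e h)
    (hs : HasSimpleSpectrum (koopmanZero T hT.toMeasurePreserving)) :
    HasSimpleSpectrum (koopmanZero (twist T)
      (measurePreserving_twist T hT.toMeasurePreserving)) := by
  have hT' := hT.toMeasurePreserving
  obtain ⟨f, hf⟩ := exists_isCyclicMeanZero hs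
  -- The term `f ⊗ 1` suffices for both kinds of tensors with a constant factor, as the operator
  -- takes it to `1 ⊗ f`.
  refine (hasSimpleSpectrum_restrictUnitary_iff _ isClosed_meanZero).2
    ⟨tensor f (Lp.const 2 μ (1 : ℂ)) + tensor f f, (meanZero _).add_mem
      (tensor_mem_meanZero_left hf.mem _) (tensor_mem_meanZero_left hf.mem _), fun y hy h => ?_⟩
  -- This closed reducing subspace contains the proposed cyclic vector. Once it contains all
  -- mean-zero tensors, `y` is orthogonal to them and vanishes.
  let C := orbitOrthogonal (twistOp T hT') y
  have hC : IsClosed (C : Set (Lp ℂ 2 (μ.prod μ))) := isClosed_orbitOrthogonal _ _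
  have hR : ∀ x ∈ C, twistOp T hT' x ∈ C := fun x => apply_mem_orbitOrthogonal
  have hR' : ∀ x ∈ C, (twistOp T hT')⁻¹ x ∈ C := fun x => inv_apply_mem_orbitOrthogonal
  have hS : ∀ x ∈ C, squareOp T hT' x ∈ C := fun x hx => by
    rw [← twistOp_twistOp]
    exact hR _ (hR _ hx)
  have hS' : ∀ x ∈ C, (squareOp T hT')⁻¹ x ∈ C := fun x hx => by
    have : (squareOp T hT')⁻¹ x = (twistOp T hT')⁻¹ ((twistOp T hT')⁻¹ x) := by
      apply (squareOp T hT').injective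
      rw [apply_inv_self, ← twistOp_twistOp, apply_inv_self, apply_inv_self]
    rw [this]
    exact hR' _ (hR' _ hx)
  have hv : tensor f (Lp.const 2 μ (1 : ℂ)) + tensor f f ∈ C := h
  have hsymm : ∀ x ∈ meanZero μ, ∀ y ∈ meanZero μ, tensor x y + tensor y x ∈ C :=
    fun x hx y hy => H.symm_tensor_mem hC hS hS' (hf.sub hT) hv (by
      simp only [map_add, map_sub, leftOp_tensor, rightOp_tensor, squareOp_tensor, koopman_one,
        sub_apply]
      abel) hx hy
  have htens : ∀ x ∈ meanZero μ, ∀ y ∈ meanZero μ, tensor x y ∈ C :=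
    fun x hx y hy => hf.tensor_mem hC hR hsymm hx hy
  have hf1 : tensor f (Lp.const 2 μ (1 : ℂ)) ∈ C := by
    have := C.sub_mem hv (htens f hf.mem f hf.mem)
    simpa using this
  have hleft : ∀ x ∈ meanZero μ, tensor x (Lp.const 2 μ (1 : ℂ)) ∈ C := by
    intro x hx
    refine hf.linear_mem (tensor.flip (Lp.const 2 μ (1 : ℂ))) hC (fun n => ?_) hx
    have h1 := zpow_mem hS hS' n _ hf1
    rw [zpow_tensor (squareOp_tensor T hT')] at h1
    have h2 : (koopman T hT' ^ n) (Lp.const 2 μ (1 : ℂ)) = Lp.const 2 μ (1 : ℂ) :=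
      zpow_apply_of_apply_eq (U := koopman T hT') (koopman_one T hT') n
    rwa [h2] at h1
  have hright : ∀ x ∈ meanZero μ, tensor (Lp.const 2 μ (1 : ℂ)) x ∈ C := by
    intro x hx
    have := hR _ (hleft _ hx)
    rwa [twistOp_tensor, koopman_one] at this
  exact eq_zero_of_inner_tensor_meanZero hy
    (fun x hx => inner_eq_zero_of_mem_orbitOrthogonal (hleft x hx))
    (fun x hx => inner_eq_zero_of_mem_orbitOrthogonal (hright x hx))
    (fun x hx z hz => inner_eq_zero_of_mem_orbitOrthogonal (htens x hx z hz))

/-- The operator `T ⊗ T` has a symmetric vector which is cyclic in the space of symmetric functions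
with zero mean. -/
theorem HasWeakLimit.exists_cyclic_symm (hT : Ergodic T μ)
    (H : HasWeakLimit (koopman T hT.toMeasurePreserving) k b e h)
    (hs : HasSimpleSpectrum (koopmanZero T hT.toMeasurePreserving)) :
    ∃ v ∈ meanZero (μ.prod μ), swapOp μ v = v ∧ ∀ y ∈ meanZero (μ.prod μ), swapOp μ y = y →
      (∀ n : ℤ, ⟪(squareOp T hT.toMeasurePreserving ^ n) v, y⟫_ℂ = 0) → y = 0 := by
  have hT' := hT.toMeasurePreserving
  obtain ⟨f, hf⟩ := exists_isCyclicMeanZero hs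
  refine ⟨tensor f (Lp.const 2 μ (1 : ℂ)) + tensor (Lp.const 2 μ (1 : ℂ)) f + tensor f f,
    (meanZero _).add_mem ((meanZero _).add_mem (tensor_mem_meanZero_left hf.mem _)
      (tensor_mem_meanZero_right hf.mem _)) (tensor_mem_meanZero_left hf.mem _), ?_,
    fun y hy hys h => ?_⟩
  · simp only [map_add, swapOp_tensor]
    abel
  let C := orbitOrthogonal (squareOp T hT') y
  have hC : IsClosed (C : Set (Lp ℂ 2 (μ.prod μ))) := isClosed_orbitOrthogonal _ _
  have hS : ∀ x ∈ C, squareOp T hT' x ∈ C := fun x => apply_mem_orbitOrthogonal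
  have hS' : ∀ x ∈ C, (squareOp T hT')⁻¹ x ∈ C := fun x => inv_apply_mem_orbitOrthogonal
  have hv : tensor f (Lp.const 2 μ (1 : ℂ)) + tensor (Lp.const 2 μ (1 : ℂ)) f + tensor f f ∈ C :=
    h
  have hsymm : ∀ x ∈ meanZero μ, ∀ y ∈ meanZero μ, tensor x y + tensor y x ∈ C :=
    fun x hx y hy => H.symm_tensor_mem hC hS hS' (hf.sub hT) hv (by
      simp only [map_add, map_sub, leftOp_tensor, rightOp_tensor, squareOp_tensor, koopman_one,
        sub_apply]
      abel) hx hy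
  have hff : tensor f f ∈ C := by
    have h1 := hsymm f hf.mem f hf.mem
    rw [← two_smul ℂ] at h1
    exact (Submodule.smul_mem_iff _ two_ne_zero).1 h1
  have hf1 : tensor f (Lp.const 2 μ (1 : ℂ)) + tensor (Lp.const 2 μ (1 : ℂ)) f ∈ C := by
    have := C.sub_mem hv hff
    simpa using this
  have hone : ∀ x ∈ meanZero μ,
      tensor x (Lp.const 2 μ (1 : ℂ)) + tensor (Lp.const 2 μ (1 : ℂ)) x ∈ C := by
    intro x hx
    let B : Lp ℂ 2 μ →L[ℂ] Lp ℂ 2 (μ.prod μ) :=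
      tensor.flip (Lp.const 2 μ (1 : ℂ)) + tensor (Lp.const 2 μ (1 : ℂ))
    have hB : ∀ x, B x = tensor x (Lp.const 2 μ (1 : ℂ)) + tensor (Lp.const 2 μ (1 : ℂ)) x :=
      fun x => by rw [add_apply, ContinuousLinearMap.flip_apply]
    rw [← hB]
    refine hf.linear_mem B hC (fun n => ?_) hx
    rw [hB]
    have h1 := zpow_mem hS hS' n _ hf1
    rw [map_add, zpow_tensor (squareOp_tensor T hT'), zpow_tensor (squareOp_tensor T hT')] at h1
    have h2 : (koopman T hT' ^ n) (Lp.const 2 μ (1 : ℂ)) = Lp.const 2 μ (1 : ℂ) :=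
      zpow_apply_of_apply_eq (U := koopman T hT') (koopman_one T hT') n
    rwa [h2] at h1
  -- As `y` is symmetric, both halves of a symmetrized tensor have the same inner product with it.
  have key : ∀ x z, tensor x z + tensor z x ∈ C → ⟪tensor x z, y⟫_ℂ = 0 := by
    intro x z hxz
    have h1 := inner_eq_zero_of_mem_orbitOrthogonal hxz
    have h2 : ⟪tensor z x, y⟫_ℂ = ⟪tensor x z, y⟫_ℂ := by
      rw [← swapOp_tensor, inner_swapOp_left, hys]
    rw [inner_add_left, h2, ← two_mul] at h1
    exact (mul_eq_zero.1 h1).resolve_left two_ne_zero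
  exact eq_zero_of_inner_tensor_meanZero hy (fun x hx => key _ _ (hone x hx))
    (fun x hx => key _ _ (by rw [add_comm]; exact hone x hx))
    (fun x hx z hz => key _ _ (hsymm x hx z hz))

end Cyclic

end

end SpectralErgodic

namespace SpectralErgodic

noncomputable section

/-! ### Multiplicity two from an anticommuting intertwiner -/

section Involution

variable {K : Type*} [NormedAddCommGroup K] [InnerProductSpace ℂ K]

theorem map_eq_of_mem {U : K ≃ₗᵢ[ℂ] K} {S : Submodule ℂ K} (h : ∀ x ∈ S, U x ∈ S)
    (h' : ∀ x ∈ S, U⁻¹ x ∈ S) : S.map (U.toLinearEquiv : K →ₗ[ℂ] K) = S := by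
  ext x
  rw [Submodule.mem_map]
  constructor
  · rintro ⟨y, hy, rfl⟩
    exact h y hy
  · intro hx
    exact ⟨U⁻¹ x, h' x hx, apply_inv_self U x⟩

/-- The eigenspaces of a unitary operator. -/
def unitaryEigenspace (V : K ≃ₗᵢ[ℂ] K) (c : ℂ) : Submodule ℂ K where
  carrier := {u | V u = c • u}
  zero_mem' := by simp
  add_mem' {u v} hu hv := by
    change V (u + v) = c • (u + v)
    rw [map_add, smul_add]
    exact congrArg₂ _ hu hv
  smul_mem' d u hu := by
    change V (d • u) = c • d • u
    rw [map_smul, smul_comm]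
    exact congrArg _ hu

theorem mem_unitaryEigenspace {V : K ≃ₗᵢ[ℂ] K} {c : ℂ} {u : K} :
    u ∈ unitaryEigenspace V c ↔ V u = c • u := Iff.rfl

theorem isClosed_unitaryEigenspace (V : K ≃ₗᵢ[ℂ] K) (c : ℂ) :
    IsClosed (unitaryEigenspace V c : Set K) :=
  isClosed_eq V.continuous (continuous_id.const_smul c)

theorem map_unitaryEigenspace {U V : K ≃ₗᵢ[ℂ] K} (h : ∀ x, V (U x) = U (V x)) (c : ℂ) :
    (unitaryEigenspace V c).map (U.toLinearEquiv : K →ₗ[ℂ] K) = unitaryEigenspace V c := by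
  apply map_eq_of_mem
  · intro x hx
    rw [mem_unitaryEigenspace] at hx ⊢
    rw [h, hx, map_smul]
  · intro x hx
    rw [mem_unitaryEigenspace] at hx ⊢
    apply U.injective
    rw [← h, apply_inv_self, hx, map_smul, apply_inv_self]

variable {V : K ≃ₗᵢ[ℂ] K}

theorem inner_involution_left (hV : ∀ x, V (V x) = x) (x y : K) : ⟪V x, y⟫_ℂ = ⟪x, V y⟫_ℂ := by
  rw [← V.inner_map_map, hV]

theorem unitaryEigenspace_orthogonal (hV : ∀ x, V (V x) = x) :
    unitaryEigenspace V 1 ⟂ unitaryEigenspace V (-1) := by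
  rw [Submodule.isOrtho_iff_inner_eq]
  intro u hu v hv
  rw [mem_unitaryEigenspace, one_smul] at hu
  rw [mem_unitaryEigenspace, neg_one_smul] at hv
  apply self_eq_neg.1
  conv_lhs => rw [← hu, inner_involution_left hV, hv, inner_neg_right]

theorem unitaryEigenspace_sup (hV : ∀ x, V (V x) = x) :
    unitaryEigenspace V 1 ⊔ unitaryEigenspace V (-1) = ⊤ := by
  rw [eq_top_iff]
  intro u _
  rw [Submodule.mem_sup]
  refine ⟨(1 / 2 : ℂ) • (u + V u), ?_, (1 / 2 : ℂ) • (u - V u), ?_, by module⟩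
  · refine Submodule.smul_mem _ _ ?_
    rw [mem_unitaryEigenspace, map_add, hV, one_smul, add_comm]
  · refine Submodule.smul_mem _ _ ?_
    rw [mem_unitaryEigenspace, map_sub, hV, neg_one_smul, neg_sub]

/-- A unitary operator has homogeneous spectrum of multiplicity two if it commutes with an
involution `V`, has simple spectrum on the `V`-even vectors and commutes with an injective
operator with dense range which anticommutes with `V`. -/
theorem hasHomogeneousSpectrum_two [CompleteSpace K] {U : K ≃ₗᵢ[ℂ] K}
    (hV : ∀ x, V (V x) = x)
    (hVU : ∀ x, V (U x) = U (V x)) {B : K →L[ℂ] K} (hVB : ∀ x, V (B x) = -B (V x))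
    (hBU : ∀ x, B (U x) = U (B x)) (hB : ∀ x, B x = 0 → x = 0)
    (hB' : ∀ y, (∀ x, ⟪B x, y⟫_ℂ = 0) → y = 0) {v : K} (hv : V v = v)
    (hcyc : ∀ y, V y = y → (∀ n : ℤ, ⟪(U ^ n) v, y⟫_ℂ = 0) → y = 0) :
    HasHomogeneousSpectrum U 2 := by
  have hc (c : ℂ) : CompleteSpace (unitaryEigenspace V c) :=
    (isClosed_unitaryEigenspace V c).completeSpace_coe
  have hsimple : HasSimpleSpectrum (restrictUnitary U (unitaryEigenspace V 1)
      (map_unitaryEigenspace hVU 1)) := by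
    refine (hasSimpleSpectrum_restrictUnitary_iff _ (isClosed_unitaryEigenspace V 1)).2
      ⟨v, ?_, fun y hy h => hcyc y ?_ h⟩
    · rw [mem_unitaryEigenspace, one_smul, hv]
    · rwa [mem_unitaryEigenspace, one_smul] at hy
  let B' : unitaryEigenspace V 1 →L[ℂ] unitaryEigenspace V (-1) :=
    (B ∘L (unitaryEigenspace V 1).subtypeL).codRestrict (unitaryEigenspace V (-1)) (fun u => by
      have hu := mem_unitaryEigenspace.1 u.2
      rw [one_smul] at hu
      rw [mem_unitaryEigenspace, neg_one_smul]
      change V (B u) = -B u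
      rw [hVB, hu])
  have hequiv : UnitarilyEquivalent
      (restrictUnitary U (unitaryEigenspace V 1) (map_unitaryEigenspace hVU 1))
      (restrictUnitary U (unitaryEigenspace V (-1)) (map_unitaryEigenspace hVU (-1))) := by
    refine UnitarilyEquivalent.of_intertwining B' (fun u => Subtype.ext (hBU u))
      (fun u hu => Subtype.ext (hB u (congrArg Subtype.val hu)))
      (denseRange_of_adjoint_injective B' fun y hy => Subtype.ext (hB' y fun w => ?_))
    have hys := mem_unitaryEigenspace.1 y.2
    rw [neg_one_smul] at hys
    have hsum : ⟪B (w + V w), (y : K)⟫_ℂ = 0 := by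
      refine hy ⟨w + V w, ?_⟩
      rw [mem_unitaryEigenspace, one_smul, map_add, hV, add_comm]
    -- The operator `B` takes the odd vector `w - V w` to an even one, which is orthogonal to the
    -- odd vector `y`. So `y` is orthogonal to the whole range of `B`, not only to the image of the
    -- even vectors.
    have hdiff : ⟪B (w - V w), (y : K)⟫_ℂ = 0 := by
      have h2 : V (B (w - V w)) = B (w - V w) := by
        rw [hVB, map_sub, hV, ← map_neg, neg_sub]
      apply self_eq_neg.1
      conv_lhs => rw [← h2, inner_involution_left hV, hys, inner_neg_right]
    have h3 : w = (1 / 2 : ℂ) • (w + V w) + (1 / 2 : ℂ) • (w - V w) := by module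
    rw [h3, map_add, map_smul, map_smul, inner_add_left, inner_smul_left, inner_smul_left, hsum,
      hdiff]
    simp only [mul_zero, add_zero]
  let c : Fin 2 → ℂ := ![1, -1]
  refine ⟨fun i => unitaryEigenspace V (c i), fun i => map_unitaryEigenspace hVU (c i),
    ?_, ?_, ?_, ?_⟩
  · intro i j hij
    fin_cases i <;> fin_cases j
    · exact absurd rfl hij
    · exact unitaryEigenspace_orthogonal hV
    · exact (unitaryEigenspace_orthogonal hV).symm
    · exact absurd rfl hij
  · rw [eq_top_iff, ← unitaryEigenspace_sup hV]
    exact sup_le (le_iSup (fun i => unitaryEigenspace V (c i)) 0)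
      (le_iSup (fun i => unitaryEigenspace V (c i)) 1)
  · intro i
    fin_cases i
    · exact hsimple
    · exact hsimple.of_unitarilyEquivalent hequiv
  · intro i j
    fin_cases i <;> fin_cases j
    · exact UnitarilyEquivalent.refl _
    · exact hequiv
    · exact hequiv.symm
    · exact UnitarilyEquivalent.refl _

end Involution

/-! ### Homogeneous spectrum of the Cartesian square -/

section Homogeneous

variable {X : Type*} [MeasurableSpace X] {μ : Measure X} [IsProbabilityMeasure μ]
  {T : X ≃ᵐ X} {k : ℕ → ℕ} {b e h : ℝ}

variable (T) in
/-- The operator `T ⊗ 1 - 1 ⊗ T` on the functions with zero mean. -/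
def diffOp (hT : MeasurePreserving T μ μ) : meanZero (μ.prod μ) →L[ℂ] meanZero (μ.prod μ) :=
  unitaryCLM (koopmanZero _ (measurePreserving_fst_coord T hT)) -
    unitaryCLM (koopmanZero _ (measurePreserving_snd_coord T hT))

/-- The Cartesian square has homogeneous spectrum of multiplicity two. -/
theorem HasWeakLimit.hasHomogeneousSpectrum_square (hT : Ergodic T μ)
    (H : HasWeakLimit (koopman T hT.toMeasurePreserving) k b e h)
    (hs : HasSimpleSpectrum (koopmanZero T hT.toMeasurePreserving)) :
    HasHomogeneousSpectrum (koopmanZero (square T)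
      (measurePreserving_square T hT.toMeasurePreserving)) 2 := by
  have hT' := hT.toMeasurePreserving
  have : CompleteSpace (meanZero (μ.prod μ)) := isClosed_meanZero.completeSpace_coe
  obtain ⟨v, hv, hvs, hcyc⟩ := H.exists_cyclic_symm hT hs
  refine hasHomogeneousSpectrum_two
    (V := koopmanZero MeasurableEquiv.prodComm (measurePreserving_prodComm μ))
    (B := diffOp T hT') (v := ⟨v, hv⟩) (fun u => Subtype.ext (swapOp_swapOp _))
    (fun u => Subtype.ext (swapOp_squareOp T hT' _)) (fun u => Subtype.ext ?_)
    (fun u => Subtype.ext ?_) (fun u hu => Subtype.ext ?_) (fun u hu => Subtype.ext ?_)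
    (Subtype.ext hvs) (fun y hy h => Subtype.ext (hcyc y y.2 (congrArg Subtype.val hy)
      fun n => ?_))
  · change swapOp μ (leftOp T hT' u - rightOp T hT' u) =
      -(leftOp T hT' (swapOp μ u) - rightOp T hT' (swapOp μ u))
    rw [map_sub, swapOp_leftOp, swapOp_rightOp, neg_sub]
  · change leftOp T hT' (squareOp T hT' u) - rightOp T hT' (squareOp T hT' u) =
      squareOp T hT' (leftOp T hT' u - rightOp T hT' u)
    rw [map_sub]
    congr 1
    · rw [← leftOp_rightOp, ← leftOp_rightOp, rightOp_leftOp, leftOp_rightOp]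
    · rw [← rightOp_leftOp, ← rightOp_leftOp, leftOp_rightOp, rightOp_leftOp]
  · refine H.eq_zero_of_leftOp_eq_rightOp hT u.2 ?_
    exact sub_eq_zero.1 (congrArg Subtype.val hu)
  -- Orthogonality to the range of `L - R` means `L⁻¹ u = R⁻¹ u`, tested on the difference itself.
  -- Applying `L R` gives `R u = L u`, the case of injectivity.
  · have hz : (leftOp T hT')⁻¹ u - (rightOp T hT')⁻¹ u = 0 := by
      let z : Lp ℂ 2 (μ.prod μ) := (leftOp T hT')⁻¹ u - (rightOp T hT')⁻¹ u
      have h2 : ⟪leftOp T hT' z - rightOp T hT' z, (u : Lp ℂ 2 (μ.prod μ))⟫_ℂ = 0 :=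
        hu ⟨z, (meanZero _).sub_mem (koopman_inv_mem_meanZero u.2)
          (koopman_inv_mem_meanZero u.2)⟩
      have h3 : ∀ U : Lp ℂ 2 (μ.prod μ) ≃ₗᵢ[ℂ] Lp ℂ 2 (μ.prod μ),
          ⟪z, U⁻¹ u⟫_ℂ = ⟪U z, (u : Lp ℂ 2 (μ.prod μ))⟫_ℂ := fun U => by
        rw [← U.inner_map_map, apply_inv_self]
      rw [inner_sub_left, ← h3, ← h3, ← inner_sub_right] at h2
      exact inner_self_eq_zero.1 h2
    refine H.eq_zero_of_leftOp_eq_rightOp hT u.2 ?_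
    have h2 := congrArg (squareOp T hT') (sub_eq_zero.1 hz)
    rw [← leftOp_rightOp, ← leftOp_rightOp, apply_inv_self, leftOp_rightOp, ← rightOp_leftOp,
      apply_inv_self] at h2
    exact h2.symm
  · rw [← h n, Submodule.coe_inner]
    unfold koopmanZero
    rw [restrictUnitary_zpow_apply]
    rfl

end Homogeneous

end

end SpectralErgodic

namespace SpectralErgodic

noncomputable section

/-! ### Absence of an atom at one -/

section Atom

variable {E : Type*} [NormedAddCommGroup E] [InnerProductSpace ℂ E]

theorem iterate_eq_pow_apply (U : E ≃ₗᵢ[ℂ] E) (n : ℕ) (x : E) :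
    (unitaryCLM U)^[n] x = (U ^ n) x := by
  induction n with
  | zero => rfl
  | succ n ih =>
    rw [Function.iterate_succ_apply', ih, pow_succ']
    rfl

theorem tendsto_average_pow {z : ℂ} (hz : ‖z‖ = 1) :
    Tendsto (fun N : ℕ => (N : ℂ)⁻¹ * ∑ n ∈ Finset.range N, z ^ n) atTop
      (𝓝 (({1} : Set ℂ).indicator 1 z)) := by
  by_cases h1 : z = 1
  · subst h1
    refine tendsto_const_nhds.congr' ?_
    filter_upwards [eventually_ne_atTop 0] with N hN
    have : (N : ℂ) ≠ 0 := by exact_mod_cast hN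
    simp [this]
  · have h0 : ({1} : Set ℂ).indicator 1 z = (0 : ℂ) := by simp [h1]
    rw [h0]
    have hne : ‖z - 1‖ ≠ 0 := by rwa [norm_ne_zero_iff, sub_ne_zero]
    have hlim : Tendsto (fun N : ℕ => (N : ℝ)⁻¹ * (2 / ‖z - 1‖)) atTop (𝓝 0) := by
      simpa using (tendsto_inv_atTop_nhds_zero_nat (𝕜 := ℝ)).mul_const (2 / ‖z - 1‖)
    refine squeeze_zero_norm (fun N => ?_) hlim
    rw [geom_sum_eq h1, norm_mul, norm_inv, norm_div, Complex.norm_natCast]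
    gcongr
    refine (norm_sub_le _ _).trans ?_
    rw [norm_pow, hz]
    norm_num

theorem norm_average_pow_le {z : ℂ} (hz : ‖z‖ = 1) (N : ℕ) :
    ‖(N : ℂ)⁻¹ * ∑ n ∈ Finset.range N, z ^ n‖ ≤ 1 := by
  rw [norm_mul, norm_inv, Complex.norm_natCast]
  have h : ‖∑ n ∈ Finset.range N, z ^ n‖ ≤ N := by
    refine (norm_sum_le _ _).trans ?_
    simp [norm_pow, hz]
  exact (mul_le_mul_of_nonneg_left h (by positivity)).trans inv_mul_le_one

theorem continuous_circle_integrable {Y : Type*} [TopologicalSpace Y] [CompactSpace Y]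
    [MeasurableSpace Y] [OpensMeasurableSpace Y] {ν : Measure Y} [IsFiniteMeasure ν]
    {f : Y → ℂ} (hf : Continuous f) : Integrable f ν :=
  hf.integrable_of_hasCompactSupport (HasCompactSupport.of_compactSpace f)

/-- The spectral measures of a unitary operator without fixed vectors have no atom at one. -/
theorem IsSpectralMeasure.singleton_one_eq_zero [CompleteSpace E] {U : E ≃ₗᵢ[ℂ] E} {x : E}
    {ν : Measure Circle} (hν : IsSpectralMeasure U x ν) (hU : ∀ y, U y = y → y = 0) :
    ν {1} = 0 := by
  have := hν.finite
  -- By the mean ergodic theorem these averages tend to zero. On the circle they are integrals of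
  -- averages of `z ^ n`, which tend to the mass of the point `1`.
  have h1 : Tendsto (fun N : ℕ => ⟪x, birkhoffAverage ℂ (unitaryCLM U) _root_.id N x⟫_ℂ) atTop
      (𝓝 0) := by
    have h2 := (unitaryCLM U).tendsto_birkhoffAverage_orthogonalProjection (norm_unitaryCLM_le U) x
    have h3 : (((unitaryCLM U).eqLocus (1 : E →L[ℂ] E)).orthogonalProjectionOnto x : E) = 0 :=
      hU _ (((unitaryCLM U).eqLocus (1 : E →L[ℂ] E)).orthogonalProjectionOnto x).2
    rw [h3] at h2
    simpa using (tendsto_const_nhds (x := x)).inner (𝕜 := ℂ) h2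
  have h2 : ∀ N : ℕ, ⟪x, birkhoffAverage ℂ (unitaryCLM U) _root_.id N x⟫_ℂ =
      ∫ z : Circle, (N : ℂ)⁻¹ * ∑ n ∈ Finset.range N, (z : ℂ) ^ n ∂ν := by
    intro N
    rw [integral_const_mul, integral_finsetSum _ fun n _ =>
      continuous_circle_integrable (by fun_prop)]
    simp only [birkhoffAverage, birkhoffSum, inner_smul_right, inner_sum, id,
      iterate_eq_pow_apply]
    congr 1
    refine Finset.sum_congr rfl fun n _ => ?_
    have := hν.fourier n
    simpa using this
  have h3 : Tendsto (fun N : ℕ => ∫ z : Circle, (N : ℂ)⁻¹ * ∑ n ∈ Finset.range N, (z : ℂ) ^ n ∂ν)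
      atTop (𝓝 (∫ z : Circle, ({1} : Set ℂ).indicator 1 (z : ℂ) ∂ν)) := by
    refine tendsto_integral_of_dominated_convergence (fun _ => 1) (fun N => ?_)
      (integrable_const 1) (fun N => ?_) ?_
    · exact (continuous_circle_integrable (by fun_prop)).aestronglyMeasurable
    · exact Eventually.of_forall fun z => norm_average_pow_le (Circle.norm_coe z) N
    · exact Eventually.of_forall fun z => tendsto_average_pow (Circle.norm_coe z)
  simp only [h2] at h1
  have h4 := tendsto_nhds_unique h3 h1
  have h5 : (fun z : Circle => ({1} : Set ℂ).indicator (1 : ℂ → ℂ) (z : ℂ)) =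
      ({1} : Set Circle).indicator fun _ => 1 := by
    ext z
    by_cases hz : z = 1
    · simp [hz]
    · have : (z : ℂ) ≠ 1 := fun h => hz (Circle.ext h)
      simp [hz, this]
  rw [h5, integral_indicator_const _ (measurableSet_singleton 1), smul_eq_zero] at h4
  have h6 : ν.real {1} = 0 := h4.resolve_right one_ne_zero
  exact (measureReal_eq_zero_iff).1 h6

end Atom

/-! ### Trigonometric polynomials and weak* convergence on the circle -/

section Trigonometric

/-- The character `z ↦ zⁿ` as a continuous function on the circle. -/
def circleChar (n : ℤ) : C(Circle, ℂ) where
  toFun z := ((z ^ n : Circle) : ℂ)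
  continuous_toFun := continuous_subtype_val.comp (continuous_zpow n)

theorem circleChar_apply (n : ℤ) (z : Circle) : circleChar n z = ((z ^ n : Circle) : ℂ) := rfl

/-- The star subalgebra of trigonometric polynomials on the circle. -/
def circleTrigPoly : StarSubalgebra ℂ C(Circle, ℂ) where
  toSubalgebra := Algebra.adjoin ℂ (Set.range circleChar)
  star_mem' := by
    change Algebra.adjoin ℂ (Set.range circleChar) ≤ star (Algebra.adjoin ℂ (Set.range circleChar))
    refine Algebra.adjoin_le ?_
    rintro - ⟨n, rfl⟩
    refine Algebra.subset_adjoin ⟨-n, ContinuousMap.ext fun z => ?_⟩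
    change ((z ^ (-n) : Circle) : ℂ) = (starRingEnd ℂ) ((z ^ n : Circle) : ℂ)
    rw [zpow_neg, Circle.coe_inv_eq_conj]

/-- Products of characters are characters, so the algebra they generate is their linear span. -/
theorem circleTrigPoly_coe :
    Subalgebra.toSubmodule circleTrigPoly.toSubalgebra =
      Submodule.span ℂ (Set.range circleChar) := by
  apply Algebra.adjoin_eq_span_of_subset
  refine Set.Subset.trans ?_ Submodule.subset_span
  intro x hx
  refine Submonoid.closure_induction (fun _ => id) ⟨0, ?_⟩ ?_ hx
  · ext z
    simp [circleChar_apply]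
  · rintro - - - - ⟨m, rfl⟩ ⟨n, rfl⟩
    refine ⟨m + n, ?_⟩
    ext z
    simp [circleChar_apply, zpow_add]

/-- Stone–Weierstrass: the character with `n = 1` already separates points. -/
theorem span_circleChar_closure_eq_top :
    (Submodule.span ℂ (Set.range circleChar)).topologicalClosure = ⊤ := by
  have h : circleTrigPoly.topologicalClosure = ⊤ := by
    refine ContinuousMap.starSubalgebra_topologicalClosure_eq_top_of_separatesPoints
      circleTrigPoly fun z w hzw => ?_
    refine ⟨_, ⟨circleChar 1, Algebra.subset_adjoin ⟨1, rfl⟩, rfl⟩, ?_⟩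
    change ((z ^ (1 : ℤ) : Circle) : ℂ) ≠ ((w ^ (1 : ℤ) : Circle) : ℂ)
    rw [zpow_one, zpow_one]
    exact fun h => hzw (Circle.ext h)
  rw [← circleTrigPoly_coe]
  exact congr_arg (Subalgebra.toSubmodule <| StarSubalgebra.toSubalgebra ·) h

theorem span_toLp_circleChar_closure_eq_top (ν : Measure Circle) [IsFiniteMeasure ν] :
    (Submodule.span ℂ (Set.range fun n => ContinuousMap.toLp (E := ℂ) 1 ν ℂ
      (circleChar n))).topologicalClosure = ⊤ := by
  convert! (ContinuousMap.toLp_denseRange ℂ ν ℂ (p := 1)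
    ENNReal.one_ne_top).topologicalClosure_map_submodule span_circleChar_closure_eq_top
  rw [Submodule.map_span, ← Set.range_comp]
  rfl

/-- The functional `ψ ↦ ∫ g ψ` on `L¹`. -/
def integralMulCLM (ν : Measure Circle) [IsFiniteMeasure ν] (g : C(Circle, ℂ)) :
    Lp ℂ 1 ν →L[ℂ] ℂ :=
  LinearMap.mkContinuous
    { toFun := fun ψ => ∫ z, g z * ψ z ∂ν
      map_add' := fun ψ φ => by
        rw [← integral_add]
        · refine integral_congr_ae ?_
          filter_upwards [Lp.coeFn_add ψ φ] with z hz
          rw [hz, Pi.add_apply, mul_add]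
        · exact (L1.integrable_coeFn ψ).bdd_mul g.continuous.aestronglyMeasurable
            (Eventually.of_forall g.norm_coe_le_norm)
        · exact (L1.integrable_coeFn φ).bdd_mul g.continuous.aestronglyMeasurable
            (Eventually.of_forall g.norm_coe_le_norm)
      map_smul' := fun c ψ => by
        simp only [RingHom.id_apply, smul_eq_mul]
        rw [← integral_const_mul]
        refine integral_congr_ae ?_
        filter_upwards [Lp.coeFn_smul c ψ] with z hz
        simp [hz, mul_left_comm] }
    ‖g‖ (fun ψ => by
      change ‖∫ z, g z * ψ z ∂ν‖ ≤ ‖g‖ * ‖ψ‖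
      rw [L1.norm_eq_integral_norm, ← integral_const_mul]
      refine norm_integral_le_of_norm_le ((L1.integrable_coeFn ψ).norm.const_mul _) ?_
      refine Eventually.of_forall fun z => ?_
      rw [norm_mul]
      exact mul_le_mul_of_nonneg_right (g.norm_coe_le_norm z) (norm_nonneg _))

theorem integralMulCLM_apply (ν : Measure Circle) [IsFiniteMeasure ν] (g : C(Circle, ℂ))
    (ψ : Lp ℂ 1 ν) : integralMulCLM ν g ψ = ∫ z, g z * ψ z ∂ν := rfl

theorem norm_integralMulCLM_le (ν : Measure Circle) [IsFiniteMeasure ν] (g : C(Circle, ℂ)) :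
    ‖integralMulCLM ν g‖ ≤ ‖g‖ :=
  LinearMap.mkContinuous_norm_le _ (norm_nonneg _) _

/-- Convergence of the Fourier coefficients of a bounded sequence of functions implies its
weak* convergence. -/
theorem tendsto_integral_mul_of_char {ν : Measure Circle} [IsFiniteMeasure ν]
    {g : ℕ → C(Circle, ℂ)} {g₀ : C(Circle, ℂ)} {c : ℝ} (hg : ∀ i, ‖g i‖ ≤ c)
    (h : ∀ m : ℤ, Tendsto (fun i => ∫ z, g i z * circleChar m z ∂ν) atTop
      (𝓝 (∫ z, g₀ z * circleChar m z ∂ν))) {ψ : Circle → ℂ} (hψ : Integrable ψ ν) :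
    Tendsto (fun i => ∫ z, g i z * ψ z ∂ν) atTop (𝓝 (∫ z, g₀ z * ψ z ∂ν)) := by
  have hcongr : ∀ (f : C(Circle, ℂ)) (φ : Circle → ℂ) (Φ : Lp ℂ 1 ν), Φ =ᵐ[ν] φ →
      integralMulCLM ν f Φ = ∫ z, f z * φ z ∂ν := by
    intro f φ Φ hΦ
    rw [integralMulCLM_apply]
    refine integral_congr_ae ?_
    filter_upwards [hΦ] with z hz
    rw [hz]
  have key := tendsto_functional_of_total (F := fun i => integralMulCLM ν (g i))
    (G := integralMulCLM ν g₀) (c := c) (fun i => (norm_integralMulCLM_le ν _).trans (hg i))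
    (span_toLp_circleChar_closure_eq_top ν) (by
      rintro _ ⟨m, rfl⟩
      simp only [hcongr _ _ _ (ContinuousMap.coeFn_toLp ν (circleChar m))]
      exact h m) (hψ.toL1 ψ)
  simpa only [hcongr _ _ _ hψ.coeFn_toL1] using key

/-- Weak* convergence passes to an absolutely continuous measure. -/
theorem tendsto_integral_mul_of_absolutelyContinuous {ν ρ : Measure Circle} [IsFiniteMeasure ν]
    [IsFiniteMeasure ρ] (hρ : ρ ≪ ν) {g : ℕ → Circle → ℂ} {g₀ : Circle → ℂ}
    (h : ∀ ψ : Circle → ℂ, Integrable ψ ν →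
      Tendsto (fun i => ∫ z, g i z * ψ z ∂ν) atTop (𝓝 (∫ z, g₀ z * ψ z ∂ν)))
    {ψ : Circle → ℂ} (hψ : Integrable ψ ρ) :
    Tendsto (fun i => ∫ z, g i z * ψ z ∂ρ) atTop (𝓝 (∫ z, g₀ z * ψ z ∂ρ)) := by
  -- The density of `ρ` with respect to `ν` is absorbed into the test function.
  have h1 := h _ ((integrable_rnDeriv_smul_iff hρ).2 hψ)
  simp only [mul_smul_comm] at h1
  simpa only [integral_rnDeriv_smul hρ] using h1

end Trigonometric

end

end SpectralErgodic

namespace SpectralErgodic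

noncomputable section

/-! ### The weak limit as convergence of functions on the circle -/

section Restriction

variable {E : Type*} [NormedAddCommGroup E] [InnerProductSpace ℂ E]

theorem HasWeakLimit.restrictUnitary {U : E ≃ₗᵢ[ℂ] E} {k : ℕ → ℕ} {b e h : ℝ}
    (H : HasWeakLimit U k b e h) (S : Submodule ℂ E)
    (hS : S.map (U.toLinearEquiv : E →ₗ[ℂ] E) = S) :
    HasWeakLimit (restrictUnitary U S hS) k b e h where
  nonneg := H.nonneg
  lt_one := H.lt_one
  pos := H.pos
  lt_one' := H.lt_one'
  mul_eq := H.mul_eq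
  sum_eq_one := H.sum_eq_one
  tendsto x y := by
    refine (H.tendsto x y).congr fun i => ?_
    rw [Submodule.coe_inner, ← zpow_natCast, ← zpow_natCast, restrictUnitary_zpow_apply]
    rfl

/-- The function `zⁿ (1 - b z)` on the circle. -/
def prelimitSymbol (b : ℝ) (n : ℕ) : C(Circle, ℂ) where
  toFun z := (z : ℂ) ^ n * (1 - b * z)
  continuous_toFun := by fun_prop

/-- The function `e + h z` on the circle. -/
def limitSymbol (e h : ℝ) : C(Circle, ℂ) where
  toFun z := e + h * z
  continuous_toFun := by fun_prop

theorem prelimitSymbol_apply (b : ℝ) (n : ℕ) (z : Circle) :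
    prelimitSymbol b n z = (z : ℂ) ^ n * (1 - b * z) := rfl

theorem limitSymbol_apply (e h : ℝ) (z : Circle) : limitSymbol e h z = e + h * z := rfl

theorem norm_prelimitSymbol_le {b : ℝ} (hb : 0 ≤ b) (hb' : b < 1) (n : ℕ) :
    ‖prelimitSymbol b n‖ ≤ 2 := by
  rw [ContinuousMap.norm_le _ zero_le_two]
  intro z
  rw [prelimitSymbol_apply, norm_mul, norm_pow, Circle.norm_coe, one_pow, one_mul]
  refine (norm_sub_le _ _).trans ?_
  rw [norm_one, norm_mul, Circle.norm_coe, mul_one, Complex.norm_real, Real.norm_of_nonneg hb]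
  linarith

/-- This is the weak limit tested on the pair `U ^ m x`, `x`, with inner products read as Fourier
coefficients of `ν`. -/
theorem HasWeakLimit.tendsto_fourier {U : E ≃ₗᵢ[ℂ] E} {k : ℕ → ℕ} {b e h : ℝ}
    (H : HasWeakLimit U k b e h) {x : E} {ν : Measure Circle} (hν : IsSpectralMeasure U x ν)
    (m : ℤ) :
    Tendsto (fun i => ∫ z, prelimitSymbol b (k i) z * circleChar m z ∂ν) atTop
      (𝓝 (∫ z, limitSymbol e h z * circleChar m z ∂ν)) := by
  have := hν.finite
  have hint : ∀ n : ℤ, Integrable (fun z : Circle => ((z ^ n : Circle) : ℂ)) ν := fun n =>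
    continuous_circle_integrable (circleChar n).continuous
  have h1 := H.tendsto ((U ^ m) x) x
  have h2 : ⟪x, (e : ℂ) • (U ^ m) x + (h : ℂ) • U ((U ^ m) x)⟫_ℂ =
      ∫ z, limitSymbol e h z * circleChar m z ∂ν := by
    rw [← zpow_succ_apply, inner_add_right, inner_smul_right, inner_smul_right, hν.fourier,
      hν.fourier, ← integral_const_mul, ← integral_const_mul,
      ← integral_add ((hint _).const_mul _) ((hint _).const_mul _)]
    refine integral_congr_ae (Eventually.of_forall fun z => ?_)
    simp only [limitSymbol_apply, circleChar_apply, zpow_add, zpow_one, Circle.coe_mul]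
    ring
  rw [h2] at h1
  refine h1.congr fun i => ?_
  rw [map_sub, map_smul, ← zpow_succ_apply, inner_sub_right, inner_smul_right]
  have h3 : ∀ n : ℤ, (U ^ k i) ((U ^ n) x) = (U ^ (k i + n)) x := fun n => by
    rw [zpow_add, zpow_natCast]
    rfl
  rw [h3, h3, hν.fourier, hν.fourier, ← integral_const_mul,
    ← integral_sub (hint _) ((hint _).const_mul _)]
  refine integral_congr_ae (Eventually.of_forall fun z => ?_)
  simp only [prelimitSymbol_apply, circleChar_apply, zpow_add, zpow_one, zpow_natCast,
    Circle.coe_mul, Circle.coe_pow]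
  ring

theorem HasWeakLimit.tendsto_integral {U : E ≃ₗᵢ[ℂ] E} {k : ℕ → ℕ} {b e h : ℝ}
    (H : HasWeakLimit U k b e h) {x : E} {ν : Measure Circle} (hν : IsSpectralMeasure U x ν)
    {ψ : Circle → ℂ} (hψ : Integrable ψ ν) :
    Tendsto (fun i => ∫ z, prelimitSymbol b (k i) z * ψ z ∂ν) atTop
      (𝓝 (∫ z, limitSymbol e h z * ψ z ∂ν)) :=
  have := hν.finite
  tendsto_integral_mul_of_char (fun i => norm_prelimitSymbol_le H.nonneg H.lt_one (k i))
    (H.tendsto_fourier hν) hψ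

end Restriction

/-! ### Continuous functions as L² vectors -/

section Vectors

variable {Y : Type*} [TopologicalSpace Y] [CompactSpace Y] [MeasurableSpace Y] [BorelSpace Y]

theorem continuous_memLp_two {ρ : Measure Y} [IsFiniteMeasure ρ] {f : Y → ℂ}
    (hf : Continuous f) : MemLp f 2 ρ :=
  hf.memLp_of_hasCompactSupport (HasCompactSupport.of_compactSpace f)

/-- The conjugate of a continuous function as a vector of `L²`. -/
def conjVector (ρ : Measure Y) [IsFiniteMeasure ρ] (g : C(Y, ℂ)) : Lp ℂ 2 ρ :=
  (continuous_memLp_two (f := fun y => (starRingEnd ℂ) (g y))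
    (Complex.continuous_conj.comp g.continuous)).toLp _

theorem coeFn_conjVector (ρ : Measure Y) [IsFiniteMeasure ρ] (g : C(Y, ℂ)) :
    conjVector ρ g =ᵐ[ρ] fun y => (starRingEnd ℂ) (g y) :=
  MemLp.coeFn_toLp _

/-- The conjugation cancels the one in the first argument of the inner product, so weak* convergence
of functions becomes weak convergence of vectors. -/
theorem inner_conjVector (ρ : Measure Y) [IsFiniteMeasure ρ] (g : C(Y, ℂ)) (x : Lp ℂ 2 ρ) :
    ⟪conjVector ρ g, x⟫_ℂ = ∫ y, g y * x y ∂ρ := by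
  rw [L2.inner_def]
  refine integral_congr_ae ?_
  filter_upwards [coeFn_conjVector ρ g] with y hy
  rw [hy, RCLike.inner_apply, Complex.conj_conj, mul_comm]

theorem norm_conjVector_le (ρ : Measure Y) [IsFiniteMeasure ρ] {g : C(Y, ℂ)} {c : ℝ}
    (hg : ‖g‖ ≤ c) :
    ‖conjVector ρ g‖ ≤ (measureUnivNNReal ρ : ℝ) ^ (2 : ENNReal).toReal⁻¹ * c := by
  refine Lp.norm_le_of_ae_bound ((norm_nonneg _).trans hg) ?_
  filter_upwards [coeFn_conjVector ρ g] with y hy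
  rw [hy, RCLike.norm_conj]
  exact (g.norm_coe_le_norm y).trans hg

end Vectors

/-! ### Singularity of the convolution square -/

section Disjointness

variable {ν : Measure Circle} [IsFiniteMeasure ν] {g : ℕ → C(Circle, ℂ)} {g₀ : C(Circle, ℂ)}

theorem tendsto_inner_conjVector
    (h : ∀ ψ : Circle → ℂ, Integrable ψ ν →
      Tendsto (fun i => ∫ z, g i z * ψ z ∂ν) atTop (𝓝 (∫ z, g₀ z * ψ z ∂ν)))
    {ρ : Measure Circle} [IsFiniteMeasure ρ] (hρ : ρ ≪ ν) (x : Lp ℂ 2 ρ) :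
    Tendsto (fun i => ⟪conjVector ρ (g i), x⟫_ℂ) atTop (𝓝 ⟪conjVector ρ g₀, x⟫_ℂ) := by
  simp only [inner_conjVector]
  exact tendsto_integral_mul_of_absolutelyContinuous hρ h
    ((Lp.memLp x).integrable (by norm_num))

/-- Weak convergence of `g(z) g(w)` on the torus. -/
theorem tendsto_integral_prod {c : ℝ} (hg : ∀ i, ‖g i‖ ≤ c)
    (h : ∀ ψ : Circle → ℂ, Integrable ψ ν →
      Tendsto (fun i => ∫ z, g i z * ψ z ∂ν) atTop (𝓝 (∫ z, g₀ z * ψ z ∂ν)))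
    {M : Set (Circle × Circle)} (hM : MeasurableSet M) {Φ : Circle × Circle → ℂ}
    (hΦ : Continuous Φ) :
    Tendsto (fun i => ∫ p in M, g i p.1 * g i p.2 * Φ p ∂(ν.prod ν)) atTop
      (𝓝 (∫ p in M, g₀ p.1 * g₀ p.2 * Φ p ∂(ν.prod ν))) := by
  have hmem : MemLp (M.indicator Φ) 2 (ν.prod ν) := (continuous_memLp_two hΦ).indicator hM
  have hform : ∀ f : C(Circle, ℂ), ⟪tensor (conjVector ν f) (conjVector ν f), hmem.toLp _⟫_ℂ =
      ∫ p in M, f p.1 * f p.2 * Φ p ∂(ν.prod ν) := by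
    intro f
    rw [L2.inner_def, ← integral_indicator hM]
    have h1 : tensor (conjVector ν f) (conjVector ν f) =ᵐ[ν.prod ν]
        fun p => (starRingEnd ℂ) (f p.1) * (starRingEnd ℂ) (f p.2) := by
      have hm : MemLp (fun p : Circle × Circle => (starRingEnd ℂ) (f p.1) *
          (starRingEnd ℂ) (f p.2)) 2 (ν.prod ν) := continuous_memLp_two (by fun_prop)
      rw [tensor_ext (coeFn_conjVector ν f) (coeFn_conjVector ν f) hm.coeFn_toLp]
      exact hm.coeFn_toLp
    refine integral_congr_ae ?_
    filter_upwards [h1, hmem.coeFn_toLp] with p hp hp'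
    rw [hp, hp', RCLike.inner_apply]
    by_cases hpM : p ∈ M
    · simp [hpM, mul_comm]
    · simp [hpM]
  have key := tendsto_inner_tensor (fun i => norm_conjVector_le ν (hg i))
    (fun i => norm_conjVector_le ν (hg i))
    (tendsto_inner_conjVector h Measure.AbsolutelyContinuous.rfl)
    (tendsto_inner_conjVector h Measure.AbsolutelyContinuous.rfl) (hmem.toLp _)
  simpa only [hform] using key

/-- Weak convergence of `g(z w)` on the torus. -/
theorem tendsto_integral_mul_prod
    (h : ∀ ψ : Circle → ℂ, Integrable ψ ν →
      Tendsto (fun i => ∫ z, g i z * ψ z ∂ν) atTop (𝓝 (∫ z, g₀ z * ψ z ∂ν)))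
    {A : Set Circle} (hA : MeasurableSet A) (hac : (Measure.mconv ν ν).restrict A ≪ ν)
    {Φ : Circle × Circle → ℂ} (hΦ : Continuous Φ) :
    Tendsto (fun i => ∫ p in (fun p : Circle × Circle => p.1 * p.2) ⁻¹' A,
        g i (p.1 * p.2) * Φ p ∂(ν.prod ν)) atTop
      (𝓝 (∫ p in (fun p : Circle × Circle => p.1 * p.2) ⁻¹' A,
        g₀ (p.1 * p.2) * Φ p ∂(ν.prod ν))) := by
  let P := (ν.prod ν).restrict ((fun p : Circle × Circle => p.1 * p.2) ⁻¹' A)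
  let ρ := (Measure.mconv ν ν).restrict A
  have hmul : MeasurePreserving (fun p : Circle × Circle => p.1 * p.2) (ν.prod ν)
      (Measure.mconv ν ν) := ⟨continuous_mul.measurable, rfl⟩
  have hP : MeasurePreserving (fun p : Circle × Circle => p.1 * p.2) P ρ :=
    hmul.restrict_preimage hA
  have hmem : MemLp Φ 2 P := continuous_memLp_two hΦ
  -- Pullback along multiplication. Its adjoint turns the test function on the torus into one on the
  -- circle, square integrable for `ρ`; there `ρ ≪ ν` allows the use of the limit.
  let J : Lp ℂ 2 ρ →L[ℂ] Lp ℂ 2 P :=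
    (Lp.compMeasurePreservingₗᵢ ℂ _ hP).toContinuousLinearMap
  have hform : ∀ f : C(Circle, ℂ),
      ⟪conjVector ρ f, ContinuousLinearMap.adjoint J (hmem.toLp _)⟫_ℂ =
        ∫ p, f (p.1 * p.2) * Φ p ∂P := by
    intro f
    rw [ContinuousLinearMap.adjoint_inner_right, L2.inner_def]
    have h1 : J (conjVector ρ f) =ᵐ[P] fun p => (starRingEnd ℂ) (f (p.1 * p.2)) :=
      (Lp.coeFn_compMeasurePreserving (conjVector ρ f) hP).trans
        (hP.quasiMeasurePreserving.ae_eq_comp (coeFn_conjVector ρ f))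
    refine integral_congr_ae ?_
    filter_upwards [h1, hmem.coeFn_toLp] with p hp hp'
    rw [hp, hp', RCLike.inner_apply, Complex.conj_conj, mul_comm]
  have key := tendsto_inner_conjVector h (ρ := ρ) hac
    (ContinuousLinearMap.adjoint J (hmem.toLp _))
  simpa only [hform] using key

variable {E : Type*} [NormedAddCommGroup E] [InnerProductSpace ℂ E]

/-- The left side is the difference of the two weak limits on the torus; as `0 < e < 1`, it vanishes
only if `z = 1` or `w = 1`. -/
theorem HasWeakLimit.symbol_identity {U : E ≃ₗᵢ[ℂ] E} {k : ℕ → ℕ} {b e h : ℝ}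
    (H : HasWeakLimit U k b e h) (z w : ℂ) :
    (e + h * z) * (e + h * w) * (1 - b * (z * w)) -
      (e + h * (z * w)) * ((1 - b * z) * (1 - b * w)) =
      -(e * (1 - e)) * ((1 - z) * (1 - w)) := by
  have h1 : (e : ℂ) + h + b = 1 := by exact_mod_cast H.sum_eq_one
  rcases mul_eq_zero.1 H.mul_eq with h0 | b0
  · have h2 : (b : ℂ) = 1 - e := by
      rw [h0] at h1
      push_cast at h1
      linear_combination h1
    rw [h0, h2]
    push_cast
    ring
  · have h2 : (h : ℂ) = 1 - e := by
      rw [b0] at h1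
      push_cast at h1
      linear_combination h1
    rw [b0, h2]
    push_cast
    ring

/-- The part of the convolution square of a spectral measure which is absolutely continuous with
respect to the spectral measure vanishes. -/
theorem HasWeakLimit.mconv_eq_zero_of_restrict_absolutelyContinuous [CompleteSpace E]
    {U : E ≃ₗᵢ[ℂ] E} {k : ℕ → ℕ} {b e h : ℝ} (H : HasWeakLimit U k b e h)
    (hU : ∀ y, U y = y → y = 0) {x : E} {ν : Measure Circle} (hν : IsSpectralMeasure U x ν)
    {A : Set Circle} (hA : MeasurableSet A) (hac : (Measure.mconv ν ν).restrict A ≪ ν) :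
    Measure.mconv ν ν A = 0 := by
  have := hν.finite
  let M : Set (Circle × Circle) := (fun p => p.1 * p.2) ⁻¹' A
  have hM : MeasurableSet M := continuous_mul.measurable hA
  let q : Circle × Circle → ℂ := fun p => -(e * (1 - e)) * ((1 - p.1) * (1 - p.2))
  have hq : Continuous q := by fun_prop
  have hlim : ∀ ψ : Circle → ℂ, Integrable ψ ν →
      Tendsto (fun i => ∫ z, prelimitSymbol b (k i) z * ψ z ∂ν) atTop
        (𝓝 (∫ z, limitSymbol e h z * ψ z ∂ν)) := fun ψ hψ => H.tendsto_integral hν hψ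
  have hq' : Continuous fun p => (starRingEnd ℂ) (q p) := Complex.continuous_conj.comp hq
  -- Both limits concern the same sequence, since `z ^ k * w ^ k = (z w) ^ k`. The conjugate of `q`
  -- in the test functions turns the difference of the limits into the integral of `‖q‖ ^ 2`.
  have h1 := tendsto_integral_prod
    (fun i => norm_prelimitSymbol_le H.nonneg H.lt_one (k i)) hlim hM
    (Φ := fun p => (1 - b * (p.1 * p.2)) * (starRingEnd ℂ) (q p)) (by fun_prop)
  have h2 := tendsto_integral_mul_prod hlim hA hac
    (Φ := fun p => ((1 - b * p.1) * (1 - b * p.2)) * (starRingEnd ℂ) (q p)) (by fun_prop)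
  have h3 := tendsto_nhds_unique h1 (h2.congr fun i => by
    refine integral_congr_ae (Eventually.of_forall fun p => ?_)
    simp only [prelimitSymbol_apply, Circle.coe_mul, mul_pow]
    ring)
  rw [← sub_eq_zero, ← integral_sub] at h3
  rotate_left
  · exact (continuous_circle_integrable (by fun_prop))
  · exact (continuous_circle_integrable (by fun_prop))
  have h4 : ∫ p in M, ‖q p‖ ^ 2 ∂(ν.prod ν) = 0 := by
    have h5 : ∫ p in M, ((‖q p‖ ^ 2 : ℝ) : ℂ) ∂(ν.prod ν) = 0 := by
      rw [← h3]
      refine integral_congr_ae (Eventually.of_forall fun p => ?_)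
      have hq'' : q p = _ := (H.symbol_identity p.1 p.2).symm
      simp only [limitSymbol_apply, Circle.coe_mul]
      push_cast
      rw [← Complex.mul_conj']
      linear_combination (starRingEnd ℂ) (q p) * hq''
    rw [integral_complex_ofReal] at h5
    exact_mod_cast h5
  rw [integral_eq_zero_iff_of_nonneg (fun p => by positivity) (by
    have : Integrable (fun p => ((‖q p‖ ^ 2 : ℝ) : ℂ)) ((ν.prod ν).restrict M) :=
      continuous_circle_integrable (by fun_prop)
    simpa only [RCLike.re_eq_complex_re, Complex.ofReal_re] using this.re)] at h4
  have h5 : ∀ᵐ z ∂ν, z ≠ 1 := by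
    rw [ae_iff]
    simpa using hν.singleton_one_eq_zero hU
  have h6 : ∀ᵐ p ∂(ν.prod ν), p.1 ≠ 1 := Measure.quasiMeasurePreserving_fst.ae h5
  have h7 : ∀ᵐ p ∂(ν.prod ν), p.2 ≠ 1 := Measure.quasiMeasurePreserving_snd.ae h5
  have h8 : ∀ᵐ p ∂((ν.prod ν).restrict M), False := by
    filter_upwards [h4, ae_restrict_of_ae h6, ae_restrict_of_ae h7] with p hp h6 h7
    have hp' : q p = 0 := by simpa using hp
    have he : (e : ℂ) * (1 - e) ≠ 0 := by
      refine mul_ne_zero (by exact_mod_cast H.pos.ne') (sub_ne_zero.2 ?_)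
      exact_mod_cast H.lt_one'.ne'
    have hz : ∀ z : Circle, z ≠ 1 → (1 : ℂ) - z ≠ 0 := fun z hz h => hz
      (Circle.ext (sub_eq_zero.1 h).symm)
    exact mul_ne_zero (neg_ne_zero.2 he) (mul_ne_zero (hz _ h6) (hz _ h7)) hp'
  rw [ae_iff] at h8
  simp only [not_false_eq_true, Set.ofPred_true, Measure.restrict_apply_univ] at h8
  rw [Measure.mconv, Measure.map_apply continuous_mul.measurable hA]
  exact h8

theorem HasWeakLimit.mconv_mutuallySingular [CompleteSpace E]
    {U : E ≃ₗᵢ[ℂ] E} {k : ℕ → ℕ} {b e h : ℝ} (H : HasWeakLimit U k b e h)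
    (hU : ∀ y, U y = y → y = 0) {σ : Measure Circle} (hσ : IsMaximalSpectralMeasure U σ) :
    Measure.MutuallySingular (Measure.mconv σ σ) σ := by
  obtain ⟨x, ν, hν, -, hσν⟩ := hσ.attained
  have := hν.finite
  have := hσ.finite
  have hsing : Measure.MutuallySingular (Measure.mconv ν ν) ν := by
    -- The singular part of `ν * ν` vanishes on `s`, so `ν * ν` restricted to `s` is absolutely
    -- continuous with respect to `ν` and hence zero, while `ν` vanishes off `s`.
    obtain ⟨s, hs, hs1, hs2⟩ := Measure.mutuallySingular_singularPart (Measure.mconv ν ν) ν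
    refine ⟨s, hs, H.mconv_eq_zero_of_restrict_absolutelyContinuous hU hν hs ?_, hs2⟩
    refine Measure.AbsolutelyContinuous.mk fun t ht h0 => ?_
    rw [Measure.restrict_apply ht, Measure.haveLebesgueDecomposition_add (Measure.mconv ν ν) ν,
      Measure.add_apply]
    rw [measure_mono_null Set.inter_subset_right hs1, zero_add]
    exact withDensity_absolutelyContinuous _ _ (measure_mono_null Set.inter_subset_left h0)
  have hac : Measure.mconv σ σ ≪ Measure.mconv ν ν :=
    (hσν.prod hσν).map continuous_mul.measurable
  exact hsing.mono_ac hac hσν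

end Disjointness

end

end SpectralErgodic

/-! ### The theorem -/

theorem mainTheorem9 {X : Type*} [MeasurableSpace X] (μ : MeasureTheory.Measure X)
    [MeasureTheory.IsProbabilityMeasure μ] (T : X ≃ᵐ X) (hT : Ergodic T μ)
    (a : ℝ) (ha : a ∈ Set.Ioo (0 : ℝ) 1) (k : ℕ → ℕ) (hk : Tendsto k atTop atTop)
    (hlim :
      SpectralErgodic.WeaklyConverges
          (fun i => SpectralErgodic.koopmanCLM T hT.toMeasurePreserving ^ k i)
          ((a : ℂ) • (1 : Lp ℂ 2 μ →L[ℂ] Lp ℂ 2 μ) +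
            ((1 - a : ℝ) : ℂ) • SpectralErgodic.koopmanCLM T hT.toMeasurePreserving) ∨
      SpectralErgodic.WeaklyConverges
          (fun i => SpectralErgodic.koopmanCLM T hT.toMeasurePreserving ^ k i)
          (((1 - a : ℝ) : ℂ) •
            ∑' n : ℕ, (a : ℂ) ^ n • SpectralErgodic.koopmanCLM T hT.toMeasurePreserving ^ n)) :
    (∀ σ : Measure Circle,
      SpectralErgodic.IsMaximalSpectralMeasure
          (SpectralErgodic.koopmanZero T hT.toMeasurePreserving) σ →
        Measure.MutuallySingular (Measure.mconv σ σ) σ) ∧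
    (SpectralErgodic.HasSimpleSpectrum (SpectralErgodic.koopmanZero T hT.toMeasurePreserving) →
      SpectralErgodic.HasSimpleSpectrum
          (SpectralErgodic.koopmanZero (SpectralErgodic.twist T)
            (SpectralErgodic.measurePreserving_twist T hT.toMeasurePreserving)) ∧
      SpectralErgodic.HasHomogeneousSpectrum
          (SpectralErgodic.koopmanZero (SpectralErgodic.square T)
            (SpectralErgodic.measurePreserving_square T hT.toMeasurePreserving)) 2) := by
  obtain ⟨b, e, h, H⟩ := SpectralErgodic.exists_hasWeakLimit ha hlim
  have : CompleteSpace (SpectralErgodic.meanZero μ) :=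
    SpectralErgodic.isClosed_meanZero.completeSpace_coe
  refine ⟨fun σ hσ => ?_, fun hs => ⟨H.hasSimpleSpectrum_twist hT hs,
    H.hasHomogeneousSpectrum_square hT hs⟩⟩
  refine (H.restrictUnitary _ (SpectralErgodic.map_meanZero T
    hT.toMeasurePreserving)).mconv_mutuallySingular (fun y hy => Subtype.ext ?_) hσ
  exact SpectralErgodic.eq_zero_of_koopman_eq hT (congrArg Subtype.val hy) y.2
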